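/- Let $\mathcal M\subseteq B(H)$ be a II$_1$ factor with its faithful normal tracial state $\tau$ ($\tau(1)=1$). For $x\in\mathcal M$ and $t\ge 0$ let $\mu_x(t)=\inf\{\|xe\| : e\in\mathcal M \text{ a projection},\ \tau(1-e)\le t\}$ be the $\tau$-singular values of $x$. For $x,y\in\mathcal M^+$ write $x\precsim y$ if $\mu_x(t)\le\mu_y(t)$ for all $t\ge0$; $x\prec_w y$ if $\int_0^s\mu_x(t)\,dt\le\int_0^s\mu_y(t)\,dt$ for all $s\ge 0$; and $x\prec y$ if $x\prec_w y$ and $\tau(x)=\tau(y)$. For $x\in\mathcal M^+$ let $P^x$ be its spectral measure and let $E^x_\lambda=P^x(\lambda,\infty)$, $\lambda\in[0,\|x\|]$, be the resolution induced by $x$. Say that $x$ has continuous distribution if $E^x_0=1$ and $\lambda\mapsto E^x_\lambda$ is continuous on $[0,\|x\|]$ for the strong operator topology. For $x,y\in\mathcal M^+$, the resolution of $x$ refines that of $y$ if there is an increasing (i.e. non-decreasing) right-continuous $f:[0,\|y\|]\to[0,\|x\|]$ with $f(\|y\|)=\|x\|$ and $E^y_\lambda=E^x_{f(\lambda)}$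 for all $\lambda\in[0,\|y\|]$; it strongly refines that of $y$ if $f$ can be chosen so that moreover $f(\lambda)\ge\lambda$ for all $\lambda\in[0,\|y\|]$ and $f(\lambda)-f(\mu)\ge\lambda-\mu$ for all $\lambda>\mu$ in $[0,\|y\|]$. Let $a\in\mathcal M^+$ have continuous distribution and let $I=[0,\|a\|]$. Then one can choose, for every $b\in\mathcal M^+$, a function $h_b:I\to\mathbb R$ such that the following hold, where $h_b(a)=\int_I h_b\,dP^a$. 1. For every $b\in\mathcal M^+$, $h_b$ is nonnegative, increasing and left-continuous on $I$, $h_b(a)\in\mathcal M^+$, and $\mu_{h_b(a)}=\mu_b$. 2. For every $b\in\mathcal M^+$, the resolution of $a$ refines that of $b$ if and only if $h_b(a)=b$. Moreover, if the resolution of $a$ strongly refines that of $b$, then $h_b$ is continuous on $I$. 3. For all $b,c\in\mathcal M^+$: $c\precsim b$ if and only if $h_c(a)\le h_b(a)$; $c\prec_w b$ if and only if $h_c(a)\prec_w h_b(a)$; and $c\prec b$ if and only if $h_c(a)\prec h_b(a)$. -/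

import Mathlib

open Set MeasureTheory
open scoped CompactlySupported

noncomputable section

namespace IIOneModel

variable {H : Type*} [NormedAddCommGroup H] [InnerProductSpace ℂ H] [CompleteSpace H]

/-! ### Borel functional calculus and spectral projections -/

/-- For a self-adjoint operator `a` and a vector `x`, the positive linear functional
`f ↦ ⟪x, f(a) x⟫` on compactly supported continuous functions, where `f(a)` is the
continuous functional calculus. -/
def spectralFunctional (a : H →L[ℂ] H) (x : H) : C_c(ℝ, ℝ) →ₚ[ℝ] ℝ where
  toFun f := (inner ℂ x (cfc (fun t => f t) a x)).re
  map_add' f g := by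
    have h : cfc (fun t => (f + g) t) a = cfc (fun t => f t) a + cfc (fun t => g t) a :=
      cfc_add a (fun t => f t) (fun t => g t) f.continuous.continuousOn g.continuous.continuousOn
    rw [h, add_apply, inner_add_right, Complex.add_re]
  map_smul' c f := by
    have h : cfc (fun t => (c • f) t) a = c • cfc (fun t => f t) a :=
      cfc_smul c (fun t => f t) a f.continuous.continuousOn
    rw [h, smul_apply, ← Complex.coe_smul, inner_smul_right]
    simp
  monotone' f g hfg := by
    have h : cfc (fun t => f t) a ≤ cfc (fun t => g t) a :=
      cfc_mono (fun t _ => hfg t) f.continuous.continuousOn g.continuous.continuousOn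
    have h2 := ((ContinuousLinearMap.le_def _ _).1 h).inner_nonneg_right x
    rw [sub_apply, inner_sub_right] at h2
    have h3 := (Complex.le_def.1 h2).1
    simpa using h3

/-- The scalar spectral measure `Δ ↦ ⟪x, Pᵃ(Δ) x⟫` of the self-adjoint operator `a` at the
vector `x`: the regular Borel measure on `ℝ` that represents `f ↦ ⟪x, f(a) x⟫`. -/
def spectralMeasure (a : H →L[ℂ] H) (x : H) : Measure ℝ :=
  RealRMK.rieszMeasure (spectralFunctional a x)

open Classical in
/-- The Borel functional calculus `g(a) = ∫ g dPᵃ` of a self-adjoint operator `a`: the (unique)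
bounded operator `T` with `⟪x, T x⟫ = ∫ g d⟪x, Pᵃ(·) x⟫` for every vector `x`. By the spectral
theorem it exists for every Borel function `g` that is bounded on the spectrum of `a`. -/
def borelFC (a : H →L[ℂ] H) (g : ℝ → ℝ) : H →L[ℂ] H :=
  if h : ∃ T : H →L[ℂ] H,
      ∀ x : H, inner ℂ x (T x) = ((∫ t, g t ∂(spectralMeasure a x) : ℝ) : ℂ)
  then h.choose else 0

/-- The spectral projection `Pᵃ(Δ)` of a self-adjoint operator `a`. -/
def spectralProj (a : H →L[ℂ] H) (Δ : Set ℝ) : H →L[ℂ] H :=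
  borelFC a (Δ.indicator fun _ => 1)

/-! ### II₁ factors and their trace -/

/-- `M` is a factor of type II₁: the centre is trivial, the algebra is finite (every isometry in
`M` is unitary) and nonzero, and it has no minimal projection. -/
structure IsIIOneFactor (M : VonNeumannAlgebra H) : Prop where
  one_ne_zero : (1 : H →L[ℂ] H) ≠ 0
  center_trivial : ∀ z ∈ M, z ∈ M.commutant → ∃ c : ℂ, z = c • (1 : H →L[ℂ] H)
  finite : ∀ v ∈ M, star v * v = 1 → v * star v = 1
  no_minimal : ∀ p ∈ M, IsStarProjection p → p ≠ 0 →
    ∃ q ∈ M, IsStarProjection q ∧ q ≠ 0 ∧ q ≤ p ∧ q ≠ p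

/-- `τ`, restricted to `M`, is a faithful normal tracial state on `M`.
Only the values of `τ` on `M` matter. -/
structure IsNormalizedTrace (M : VonNeumannAlgebra H) (τ : (H →L[ℂ] H) → ℂ) : Prop where
  map_add : ∀ x ∈ M, ∀ y ∈ M, τ (x + y) = τ x + τ y
  map_smul : ∀ (c : ℂ), ∀ x ∈ M, τ (c • x) = c * τ x
  tracial : ∀ x ∈ M, ∀ y ∈ M, τ (x * y) = τ (y * x)
  nonneg : ∀ x ∈ M, 0 ≤ x → 0 ≤ (τ x).re ∧ (τ x).im = 0
  faithful : ∀ x ∈ M, 0 ≤ x → τ x = 0 → x = 0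
  map_one : τ 1 = 1
  /-- `τ (sup S) = sup τ(S)` for every upward directed set `S` of positive elements of `M` with
  supremum in `M`. -/
  normal : ∀ (S : Set (H →L[ℂ] H)) (s : H →L[ℂ] H), S.Nonempty → (∀ x ∈ S, x ∈ M ∧ 0 ≤ x) →
    DirectedOn (· ≤ ·) S → s ∈ M → IsLUB S s → IsLUB ((fun x => (τ x).re) '' S) (τ s).re

/-! ### Singular values, spectral preorder, (sub)majorization -/

/-- The `τ`-singular values `μ_x(t) = inf {‖x e‖ : e a projection of M, τ(1 - e) ≤ t}`, `t ≥ 0`. -/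
def singularValue (M : VonNeumannAlgebra H) (τ : (H →L[ℂ] H) → ℂ) (x : H →L[ℂ] H) (t : ℝ) : ℝ :=
  sInf {r : ℝ | ∃ e ∈ M, IsStarProjection e ∧ (τ (1 - e)).re ≤ t ∧ r = ‖x * e‖}

/-- `x ≾ y`: `y` spectrally dominates `x`. -/
def SpectrallyDominated (M : VonNeumannAlgebra H) (τ : (H →L[ℂ] H) → ℂ)
    (x y : H →L[ℂ] H) : Prop :=
  ∀ t : ℝ, 0 ≤ t → singularValue M τ x t ≤ singularValue M τ y t

/-- `x ≺_w y`: `x` is sub-majorized by `y`. -/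
def Submajorized (M : VonNeumannAlgebra H) (τ : (H →L[ℂ] H) → ℂ) (x y : H →L[ℂ] H) : Prop :=
  ∀ s : ℝ, 0 ≤ s →
    ∫ t in (0 : ℝ)..s, singularValue M τ x t ≤ ∫ t in (0 : ℝ)..s, singularValue M τ y t

/-- `x ≺ y`: `x` is majorized by `y`. -/
def Majorized (M : VonNeumannAlgebra H) (τ : (H →L[ℂ] H) → ℂ) (x y : H →L[ℂ] H) : Prop :=
  Submajorized M τ x y ∧ τ x = τ y

/-! ### Resolutions, refinement, continuous distribution -/

/-- A family of operators indexed by the interval `[lo, hi]`; only the values of `E` on that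
interval matter. -/
structure OperatorFamily (H : Type*) [NormedAddCommGroup H] [InnerProductSpace ℂ H] where
  lo : ℝ
  hi : ℝ
  E : ℝ → H →L[ℂ] H

/-- The bounded right spectral resolution `E_l = Pᵃ(l, ∞)`, `l ∈ [0, ‖a‖]`, induced by the
positive operator `a`. -/
def inducedResolution (a : H →L[ℂ] H) : OperatorFamily H where
  lo := 0
  hi := ‖a‖
  E := fun l => spectralProj a (Ioi l)

/-- The atoms of a resolution: the points of `(lo, hi]` at which it is discontinuous in the strong
operator topology, and also `lo` if the value there is not `1`. -/
def OperatorFamily.atoms (F : OperatorFamily H) : Set ℝ :=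
  {l | (l ∈ Ioc F.lo F.hi ∧
      ¬ ∀ x : H, ContinuousWithinAt (fun s => F.E s x) (Icc F.lo F.hi) l) ∨
    (l = F.lo ∧ F.E F.lo ≠ 1)}

/-- The positive operator `a` has continuous distribution: its resolution is diffuse. -/
def HasContinuousDistribution (a : H →L[ℂ] H) : Prop :=
  (inducedResolution a).atoms = ∅

/-- `(F', f)` is a refinement of `F`. -/
structure IsRefinementMap (F' F : OperatorFamily H) (f : ℝ → ℝ) : Prop where
  mapsTo : MapsTo f (Icc F.lo F.hi) (Icc F'.lo F'.hi)
  monotone : MonotoneOn f (Icc F.lo F.hi)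
  right_continuous : ∀ l ∈ Icc F.lo F.hi, ContinuousWithinAt f (Icc l F.hi) l
  map_hi : f F.hi = F'.hi
  eq : ∀ l ∈ Icc F.lo F.hi, F.E l = F'.E (f l)

/-- `F'` refines `F`. -/
def Refines (F' F : OperatorFamily H) : Prop :=
  ∃ f : ℝ → ℝ, IsRefinementMap F' F f

/-- `F'` strongly refines `F`. -/
def StronglyRefines (F' F : OperatorFamily H) : Prop :=
  ∃ f : ℝ → ℝ, IsRefinementMap F' F f ∧ (∀ l ∈ Icc F.lo F.hi, l ≤ f l) ∧
    ∀ l ∈ Icc F.lo F.hi, ∀ m ∈ Icc F.lo F.hi, m < l → l - m ≤ f l - f m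

/-- `h` is nonnegative, increasing and left-continuous on the interval `[0, r]`. -/
structure IsModelFunctionOn (r : ℝ) (h : ℝ → ℝ) : Prop where
  nonneg : ∀ t ∈ Icc 0 r, 0 ≤ h t
  monotone : MonotoneOn h (Icc 0 r)
  left_continuous : ∀ t ∈ Icc 0 r, ContinuousWithinAt h (Icc 0 t) t

end IIOneModel

end

/-!
The operator `h_b(a)` is the decreasing rearrangement of `b` transported to the spectral resolution
of `a`. Write `d_x(s) = τ(Pˣ(s, ∞))` for the distribution function of `x ≥ 0`. The singular value
function is its generalized inverse, `μ_x(t) ≤ s ↔ d_x(s) ≤ t` (`singularValue_le_iff`): spectral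
projections give one direction, and for the other a projection `e` with `‖x e‖ < r` makes
`Pˣ(r, ∞)` equivalent to a subprojection of `1 - e` (`IsNormalizedTrace.le_of_norm_lt_one`).
Consequently `k_b(t) = μ_b(d_a(t))` satisfies `k_b > s` exactly where `d_a < d_b(s)`. Since `a` has
continuous distribution, `d_b(s) = d_a(t₀)` for some `t₀`, and by faithfulness of `τ` the set
`{d_a < d_a(t₀)}` and the half-line `(t₀, ∞)` have the same spectral projection; so `k_b(a)` is
equidistributed with `b`, and hence has the same singular values and the same trace. If the
resolution of `a` refines that of `b`, then `k_b(a)` and `b` have the same spectral projections and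
coincide; conversely, the spectral projections of `k_b(a)` are values of the resolution of `a`.

The function `k_b` itself can fail to be continuous when `a` strongly refines `b`: if the spectrum
of `a` has a gap, `d_a` is constant there and `k_b` may jump at its right end. As only the class of
`h_b` modulo `Pᵃ`-null sets matters for `h_b(a)`, in that case `h_b` is taken to be the inverse of
a refinement map `f` instead, which is 1-Lipschitz because `f` expands distances
(`continuousOn_refinementInverse`).

All of this rests on the Borel functional calculus. Bounded Borel functions are approximated in the
`L¹` spaces of all scalar spectral measures at once by a net of continuous functions
(`exists_net_tendsto`); existence of `g(a)`, multiplicativity, commutation and the composition rule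
`spectralMeasure_borelFC` are obtained as limits along such nets.
-/

namespace IIOneModel

open Filter Topology

set_option linter.unusedSectionVars false

variable {H : Type*} [NormedAddCommGroup H] [InnerProductSpace ℂ H] [CompleteSpace H]

/-! ### Scalar spectral measures -/

theorem integral_spectralMeasure (a : H →L[ℂ] H) (x : H) (f : C_c(ℝ, ℝ)) :
    ∫ t, f t ∂(spectralMeasure a x) = (inner ℂ x (cfc (fun t => f t) a x)).re :=
  RealRMK.integral_rieszMeasure _ f

instance regular_spectralMeasure (a : H →L[ℂ] H) (x : H) : (spectralMeasure a x).Regular :=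
  RealRMK.regular_rieszMeasure _

theorem norm_inner_apply_le (T : H →L[ℂ] H) {C : ℝ} (hT : ‖T‖ ≤ C) (x y : H) :
    ‖inner ℂ x (T y)‖ ≤ C * ‖x‖ * ‖y‖ :=
  calc ‖inner ℂ x (T y)‖ ≤ ‖x‖ * ‖T y‖ := norm_inner_le_norm _ _
    _ ≤ ‖x‖ * (C * ‖y‖) := by gcongr; exact T.le_of_opNorm_le hT y
    _ = C * ‖x‖ * ‖y‖ := by ring

theorem spectralMeasure_le_of_isCompact (a : H →L[ℂ] H) (x : H) {K : Set ℝ} (hK : IsCompact K) :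
    spectralMeasure a x K ≤ ENNReal.ofReal (‖x‖ * ‖x‖) := by
  obtain ⟨f, hf1, -, hfc, hf01⟩ := exists_continuous_one_zero_of_isCompact hK
    (isClosed_empty (X := ℝ)) (disjoint_empty K)
  let F : C_c(ℝ, ℝ) := ⟨f, hfc⟩
  refine (RealRMK.rieszMeasure_le_of_eq_one (spectralFunctional a x) (f := F)
    (fun t => (hf01 t).1) hK (fun t ht => hf1 ht)).trans (ENNReal.ofReal_le_ofReal ?_)
  have h1 : ‖cfc (fun t => F t) a‖ ≤ 1 := norm_cfc_le zero_le_one fun t _ => by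
    change ‖f t‖ ≤ 1
    rw [Real.norm_of_nonneg (hf01 t).1]
    exact (hf01 t).2
  calc (inner ℂ x (cfc (fun t => F t) a x)).re ≤ ‖inner ℂ x (cfc (fun t => F t) a x)‖ :=
        Complex.re_le_norm _
    _ ≤ 1 * ‖x‖ * ‖x‖ := norm_inner_apply_le _ h1 x x
    _ = ‖x‖ * ‖x‖ := by ring

instance isFiniteMeasure_spectralMeasure (a : H →L[ℂ] H) (x : H) :
    IsFiniteMeasure (spectralMeasure a x) := by
  refine ⟨lt_of_le_of_lt ?_ (ENNReal.ofReal_lt_top (r := ‖x‖ * ‖x‖))⟩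
  rw [isOpen_univ.measure_eq_iSup_isCompact]
  simp only [iSup_le_iff]
  exact fun K _ hK => spectralMeasure_le_of_isCompact a x hK

theorem spectralMeasure_compl_spectrum (a : H →L[ℂ] H) (x : H) :
    spectralMeasure a x (spectrum ℝ a)ᶜ = 0 := by
  rw [(spectrum.isClosed a).isOpen_compl.measure_eq_iSup_isCompact]
  simp only [ENNReal.iSup_eq_zero]
  intro K hKs hK
  obtain ⟨f, hf1, hf0, hfc, hf01⟩ := exists_continuous_one_zero_of_isCompact hK
    (spectrum.isClosed (𝕜 := ℝ) a) (disjoint_left.2 fun t ht => hKs ht)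
  let F : C_c(ℝ, ℝ) := ⟨f, hfc⟩
  refine le_antisymm ((RealRMK.rieszMeasure_le_of_eq_one (spectralFunctional a x) (f := F)
    (fun t => (hf01 t).1) hK (fun t ht => hf1 ht)).trans ?_) zero_le
  have h0 : cfc (fun t => F t) a = 0 := by
    rw [← cfc_const_zero ℝ a]
    exact cfc_congr fun t ht => hf0 ht
  have : spectralFunctional a x F = (inner ℂ x (cfc (fun t => F t) a x)).re := rfl
  rw [this, h0]
  simp

theorem ae_mem_spectrum (a : H →L[ℂ] H) (x : H) :
    ∀ᵐ t ∂(spectralMeasure a x), t ∈ spectrum ℝ a :=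
  spectralMeasure_compl_spectrum a x

/-- Compact support is irrelevant, since the scalar spectral measures live on the spectrum. -/
theorem integral_spectralMeasure_of_continuous (a : H →L[ℂ] H) (x : H) {g : ℝ → ℝ}
    (hg : Continuous g) :
    ∫ t, g t ∂(spectralMeasure a x) = (inner ℂ x (cfc g a x)).re := by
  obtain ⟨f, hf1, -, hfc, hf01⟩ := exists_continuous_one_zero_of_isCompact
    (spectrum.isCompact (𝕜 := ℝ) a) (isClosed_empty (X := ℝ)) (disjoint_empty _)
  let F : C_c(ℝ, ℝ) := ⟨⟨fun t => f t * g t, f.continuous.mul hg⟩, hfc.mul_right⟩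
  have hF : ∀ t ∈ spectrum ℝ a, F t = g t := fun t ht => by
    change f t * g t = g t
    rw [hf1 ht, Pi.one_apply, one_mul]
  rw [← cfc_congr (f := fun t => F t) hF, ← integral_spectralMeasure]
  refine integral_congr_ae ?_
  filter_upwards [ae_mem_spectrum a x] with t ht using (hF t ht).symm

theorem inner_apply_self_of_isSelfAdjoint {T : H →L[ℂ] H} (hT : IsSelfAdjoint T) (x : H) :
    inner ℂ x (T x) = ((inner ℂ x (T x)).re : ℂ) := by
  have h := hT.isSymmetric x x
  refine (Complex.conj_eq_iff_re.1 ?_).symm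
  rw [inner_conj_symm]
  exact h

theorem inner_cfc (a : H →L[ℂ] H) (x : H) {g : ℝ → ℝ} (hg : Continuous g) :
    inner ℂ x (cfc g a x) = ((∫ t, g t ∂(spectralMeasure a x) : ℝ) : ℂ) := by
  rw [integral_spectralMeasure_of_continuous a x hg]
  exact inner_apply_self_of_isSelfAdjoint (cfc_predicate g a) x

theorem spectralMeasure_real_univ {a : H →L[ℂ] H} (ha : IsSelfAdjoint a) (x : H) :
    (spectralMeasure a x).real univ = ‖x‖ ^ 2 := by
  have h := integral_spectralMeasure_of_continuous a x (continuous_const (y := (1 : ℝ)))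
  rw [cfc_const_one ℝ a, one_apply_eq_self, inner_self_eq_norm_sq_to_K] at h
  simpa [← Complex.ofReal_pow] using h

theorem inner_apply_eq_integral_id {a : H →L[ℂ] H} (ha : IsSelfAdjoint a) (x : H) :
    inner ℂ x (a x) = ((∫ t, t ∂(spectralMeasure a x) : ℝ) : ℂ) := by
  have h := inner_cfc a x continuous_id
  rwa [cfc_id ℝ a] at h

theorem integrable_of_bounded {μ : Measure ℝ} [IsFiniteMeasure μ] {g : ℝ → ℝ}
    (hg : Measurable g) {C : ℝ} (hC : ∀ t, |g t| ≤ C) : Integrable g μ :=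
  Integrable.of_bound hg.aestronglyMeasurable C (ae_of_all _ hC)

/-- A bounded Borel function is the limit, along one and the same net of compactly supported
continuous functions with the same bound, in the `L¹` space of every scalar spectral measure. -/
theorem exists_net_tendsto (a : H →L[ℂ] H) {g : ℝ → ℝ} (hg : Measurable g) {C : ℝ}
    (hC : ∀ t, |g t| ≤ C) :
    ∃ f : Finset H × ℕ → C_c(ℝ, ℝ), (∀ i t, |f i t| ≤ C) ∧
      ∀ x, Tendsto (fun i => ∫ t, |g t - f i t| ∂(spectralMeasure a x)) atTop (𝓝 0) := by
  have hC0 : 0 ≤ C := (abs_nonneg _).trans (hC 0)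
  have key : ∀ i : Finset H × ℕ, ∃ f : C_c(ℝ, ℝ), (∀ t, |f t| ≤ C) ∧
      ∀ x ∈ i.1, ∫ t, |g t - f t| ∂(spectralMeasure a x) ≤ 1 / ((i.2 : ℝ) + 1) := by
    intro i
    have hint : Integrable g (∑ x ∈ i.1, spectralMeasure a x) := integrable_of_bounded hg hC
    obtain ⟨f, hfc, hfi, hf, -⟩ := hint.exists_hasCompactSupport_integral_sub_le
      (ε := 1 / ((i.2 : ℝ) + 1)) (by positivity)
    -- truncation at `±C` does not increase the distance to `g`
    have hcl : Continuous fun s : ℝ => max (-C) (min s C) := by fun_prop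
    let F : C_c(ℝ, ℝ) := ⟨⟨fun t => max (-C) (min (f t) C), hcl.comp hf⟩,
      hfc.comp_left (g := fun s : ℝ => max (-C) (min s C)) (by simp [hC0])⟩
    have hFC : ∀ t, |F t| ≤ C := fun t =>
      abs_le.2 ⟨le_max_left _ _, max_le (by linarith) (min_le_right _ _)⟩
    have hle : ∀ t, |g t - F t| ≤ |g t - f t| := fun t => by
      have h1 : g t = max (-C) (min (g t) C) := by
        rw [min_eq_left (abs_le.1 (hC t)).2, max_eq_right (abs_le.1 (hC t)).1]
      change |g t - max (-C) (min (f t) C)| ≤ _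
      conv_lhs => rw [h1]
      refine (abs_max_sub_max_le_max _ _ _ _).trans ?_
      rw [sub_self, abs_zero, max_eq_right (abs_nonneg _)]
      refine (abs_min_sub_min_le_max _ _ _ _).trans ?_
      rw [sub_self, abs_zero, max_eq_left (abs_nonneg _)]
    refine ⟨F, hFC, fun x hx => le_trans ?_ hfi⟩
    have hfint : ∀ y, Integrable (fun t => |g t - f t|) (spectralMeasure a y) := fun y =>
      ((integrable_of_bounded hg hC).sub (hf.integrable_of_hasCompactSupport hfc)).abs
    have hFint : Integrable (fun t => |g t - F t|) (spectralMeasure a x) :=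
      ((integrable_of_bounded hg hC).sub (F.continuous.integrable_of_hasCompactSupport
        F.hasCompactSupport)).abs
    simp only [Real.norm_eq_abs]
    rw [integral_finsetSum_measure fun y _ => hfint y]
    refine (integral_mono hFint (hfint x) hle).trans ?_
    exact Finset.single_le_sum (f := fun y => ∫ t, |g t - f t| ∂(spectralMeasure a y))
      (fun y _ => integral_nonneg fun t => abs_nonneg _) hx
  choose f hfC hf using key
  refine ⟨f, hfC, fun x => ?_⟩
  have hlim : Tendsto (fun i : Finset H × ℕ => 1 / ((i.2 : ℝ) + 1)) atTop (𝓝 0) :=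
    tendsto_one_div_add_atTop_nhds_zero_nat.comp (tendsto_snd.mono_left prod_atTop_atTop_eq.ge)
  refine tendsto_of_tendsto_of_tendsto_of_le_of_le' tendsto_const_nhds hlim
    (Eventually.of_forall fun i => integral_nonneg fun t => abs_nonneg _) ?_
  filter_upwards [eventually_ge_atTop (({x}, 0) : Finset H × ℕ)] with i hi
  exact hf i x (hi.1 (Finset.mem_singleton_self x))

/-- `L¹` convergence of uniformly bounded functions gives convergence of the integrals, also
against a bounded weight. -/
theorem tendsto_integral_mul_of_tendsto {ι : Type*} {l : Filter ι} {μ : Measure ℝ}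
    [IsFiniteMeasure μ] {g k : ℝ → ℝ} {f : ι → C_c(ℝ, ℝ)} (hg : Measurable g) {C : ℝ}
    (hC : ∀ t, |g t| ≤ C) (hk : Measurable k) {D : ℝ} (hD : ∀ t, |k t| ≤ D)
    (hf : Tendsto (fun i => ∫ t, |g t - f i t| ∂μ) l (𝓝 0)) :
    Tendsto (fun i => ∫ t, k t * f i t ∂μ) l (𝓝 (∫ t, k t * g t ∂μ)) := by
  have hfi : ∀ i, Integrable (f i) μ := fun i =>
    (f i).continuous.integrable_of_hasCompactSupport (f i).hasCompactSupport
  have hgi : Integrable g μ := integrable_of_bounded hg hC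
  have hkb : ∀ᵐ t ∂μ, ‖k t‖ ≤ D := ae_of_all _ hD
  rw [tendsto_iff_norm_sub_tendsto_zero]
  refine squeeze_zero (fun _ => norm_nonneg _) (fun i => ?_) (by simpa using hf.const_mul D)
  rw [← integral_sub ((hfi i).bdd_mul hk.aestronglyMeasurable hkb)
    (hgi.bdd_mul hk.aestronglyMeasurable hkb), ← integral_const_mul]
  refine (norm_integral_le_integral_norm _).trans (integral_mono ?_
    (((hgi.sub (hfi i)).abs).const_mul D) fun t => ?_)
  · exact (((hfi i).bdd_mul hk.aestronglyMeasurable hkb).sub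
      (hgi.bdd_mul hk.aestronglyMeasurable hkb)).norm
  · simp only
    rw [← mul_sub, norm_mul, Real.norm_eq_abs, Real.norm_eq_abs, abs_sub_comm (f i t)]
    exact mul_le_mul_of_nonneg_right (hD t) (abs_nonneg _)

theorem tendsto_integral_of_tendsto {ι : Type*} {l : Filter ι} {μ : Measure ℝ}
    [IsFiniteMeasure μ] {g : ℝ → ℝ} {f : ι → C_c(ℝ, ℝ)} (hg : Measurable g) {C : ℝ}
    (hC : ∀ t, |g t| ≤ C) (hf : Tendsto (fun i => ∫ t, |g t - f i t| ∂μ) l (𝓝 0)) :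
    Tendsto (fun i => ∫ t, f i t ∂μ) l (𝓝 (∫ t, g t ∂μ)) := by
  simpa using tendsto_integral_mul_of_tendsto hg hC (measurable_const (a := (1 : ℝ))) (D := 1)
    (by simp) hf

/-! ### The Borel functional calculus -/

/-- Bounded operators whose quadratic forms converge pointwise, with uniformly bounded norms,
converge weakly to a bounded operator. -/
theorem exists_inner_eq_of_tendsto {ι : Type*} {l : Filter ι} [l.NeBot] {A : ι → H →L[ℂ] H}
    {C : ℝ} (hA : ∀ i, ‖A i‖ ≤ C) {Q : H → ℂ}
    (hQ : ∀ x, Tendsto (fun i => inner ℂ (A i x) x) l (𝓝 (Q x))) :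
    ∃ T : H →L[ℂ] H, ∀ x, inner ℂ (T x) x = Q x := by
  have hB : ∀ y x, ∃ z, Tendsto (fun i => inner ℂ (A i y) x) l (𝓝 z) := by
    intro y x
    have h := ((((hQ (x + y)).sub (hQ (x - y))).add
      ((hQ (x + Complex.I • y)).const_mul Complex.I)).sub
      ((hQ (x - Complex.I • y)).const_mul Complex.I)).div_const 4
    refine ⟨_, h.congr fun i => ?_⟩
    exact (inner_map_polarization (A i : H →ₗ[ℂ] H) x y).symm
  choose B hB using hB
  have hC' : ∀ y x, ‖B y x‖ ≤ C * ‖y‖ * ‖x‖ := fun y x =>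
    le_of_tendsto (hB y x).norm <| Eventually.of_forall fun i => by
      rw [norm_inner_symm, mul_right_comm]
      exact norm_inner_apply_le (A i) (hA i) x y
  let B' : H →ₗ⋆[ℂ] H →ₗ[ℂ] ℂ := LinearMap.mk₂'ₛₗ (starRingEnd ℂ) (RingHom.id ℂ) B
    (fun y z x => tendsto_nhds_unique (hB (y + z) x) (((hB y x).add (hB z x)).congr fun i => by
      rw [map_add, inner_add_left]))
    (fun c y x => tendsto_nhds_unique (hB (c • y) x)
      (((hB y x).const_mul (starRingEnd ℂ c)).congr fun i => by
        rw [map_smul, inner_smul_left]))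
    (fun y x z => tendsto_nhds_unique (hB y (x + z)) (((hB y x).add (hB y z)).congr fun i => by
      rw [inner_add_right]))
    (fun c y x => tendsto_nhds_unique (hB y (c • x)) (((hB y x).const_mul c).congr fun i => by
      rw [inner_smul_right]))
  let B'' : H →L⋆[ℂ] H →L[ℂ] ℂ := B'.mkContinuous₂ C hC'
  refine ⟨InnerProductSpace.continuousLinearMapOfBilin B'', fun x => ?_⟩
  rw [InnerProductSpace.continuousLinearMapOfBilin_apply]
  exact tendsto_nhds_unique (hB x x) (hQ x)

theorem atTop_finset_prod_nat_neBot : (atTop : Filter (Finset H × ℕ)).NeBot := by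
  classical exact atTop_neBot

theorem exists_inner_eq_integral (a : H →L[ℂ] H) {g : ℝ → ℝ} (hg : Measurable g) {C : ℝ}
    (hC : ∀ t, |g t| ≤ C) :
    ∃ T : H →L[ℂ] H, ∀ x, inner ℂ x (T x) = ((∫ t, g t ∂(spectralMeasure a x) : ℝ) : ℂ) := by
  obtain ⟨f, hfC, hf⟩ := exists_net_tendsto a hg hC
  have := atTop_finset_prod_nat_neBot (H := H)
  obtain ⟨T, hT⟩ := exists_inner_eq_of_tendsto (l := atTop) (A := fun i => cfc (fun t => f i t) a)
    (C := C) (Q := fun x => ((∫ t, g t ∂(spectralMeasure a x) : ℝ) : ℂ))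
    (fun i => norm_cfc_le ((abs_nonneg _).trans (hC 0)) fun t _ => hfC i t) fun x => by
      have h := (Complex.continuous_ofReal.tendsto _).comp
        (tendsto_integral_of_tendsto hg hC (hf x))
      refine h.congr fun i => ?_
      have h' : inner ℂ x (cfc (fun t => f i t) a x) = _ := inner_cfc a x (f i).continuous
      rw [← inner_conj_symm, h', Complex.conj_ofReal]
      rfl
  refine ⟨T, fun x => ?_⟩
  rw [← inner_conj_symm, hT, Complex.conj_ofReal]

theorem eq_of_forall_inner_self_eq {S T : H →L[ℂ] H}
    (h : ∀ x, inner ℂ x (S x) = inner ℂ x (T x)) : S = T := by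
  have := (ext_inner_map (S : H →ₗ[ℂ] H) (T : H →ₗ[ℂ] H)).1 fun x => by
    have h' := congrArg (starRingEnd ℂ) (h x)
    rwa [inner_conj_symm, inner_conj_symm] at h'
  exact ContinuousLinearMap.coe_injective this

/-- By polarization, the operator in the definition of `borelFC` is unique. -/
theorem borelFC_eq {a T : H →L[ℂ] H} {g : ℝ → ℝ}
    (h : ∀ x, inner ℂ x (T x) = ((∫ t, g t ∂(spectralMeasure a x) : ℝ) : ℂ)) :
    borelFC a g = T := by
  have hex : ∃ T : H →L[ℂ] H,
    ∀ x : H, inner ℂ x (T x) = ((∫ t, g t ∂(spectralMeasure a x) : ℝ) : ℂ) := ⟨T, h⟩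
  rw [borelFC, dif_pos hex]
  exact eq_of_forall_inner_self_eq fun x => by rw [hex.choose_spec x, h x]

theorem inner_borelFC (a : H →L[ℂ] H) {g : ℝ → ℝ} (hg : Measurable g) {C : ℝ}
    (hC : ∀ t, |g t| ≤ C) (x : H) :
    inner ℂ x (borelFC a g x) = ((∫ t, g t ∂(spectralMeasure a x) : ℝ) : ℂ) := by
  obtain ⟨T, hT⟩ := exists_inner_eq_integral a hg hC
  rw [borelFC_eq hT, hT]

theorem tendsto_inner_of_tendsto_inner_self {ι : Type*} {l : Filter ι} {A : ι → H →L[ℂ] H}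
    {T : H →L[ℂ] H} (hA : ∀ x, Tendsto (fun i => inner ℂ x (A i x)) l (𝓝 (inner ℂ x (T x))))
    (x y : H) : Tendsto (fun i => inner ℂ x (A i y)) l (𝓝 (inner ℂ x (T y))) := by
  -- the polarization identity is available with the operator in the first slot
  have hQ : ∀ x, Tendsto (fun i => inner ℂ (A i x) x) l (𝓝 (inner ℂ (T x) x)) := fun x => by
    have h := (Complex.continuous_conj.tendsto _).comp (hA x)
    rw [inner_conj_symm] at h
    exact h.congr fun i => inner_conj_symm _ _
  have key : Tendsto (fun i => inner ℂ (A i y) x) l (𝓝 (inner ℂ (T y) x)) := by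
    have h := ((((hQ (x + y)).sub (hQ (x - y))).add
      ((hQ (x + Complex.I • y)).const_mul Complex.I)).sub
      ((hQ (x - Complex.I • y)).const_mul Complex.I)).div_const 4
    have e := inner_map_polarization (T : H →ₗ[ℂ] H) x y
    simp only [ContinuousLinearMap.coe_coe] at e
    rw [← e] at h
    exact h.congr fun i => (inner_map_polarization (A i : H →ₗ[ℂ] H) x y).symm
  have h := (Complex.continuous_conj.tendsto _).comp key
  rw [inner_conj_symm] at h
  exact h.congr fun i => inner_conj_symm _ _

/-- The Borel functional calculus at a bounded function is a weak limit of the continuous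
functional calculus along a net that also converges in `L¹` of every scalar spectral measure. -/
theorem exists_net_tendsto_borelFC (a : H →L[ℂ] H) {g : ℝ → ℝ} (hg : Measurable g) {C : ℝ}
    (hC : ∀ t, |g t| ≤ C) :
    ∃ f : Finset H × ℕ → C_c(ℝ, ℝ), (∀ i t, |f i t| ≤ C) ∧
      (∀ x, Tendsto (fun i => ∫ t, |g t - f i t| ∂(spectralMeasure a x)) atTop (𝓝 0)) ∧
      ∀ x y, Tendsto (fun i => inner ℂ x (cfc (fun t => f i t) a y)) atTop
        (𝓝 (inner ℂ x (borelFC a g y))) := by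
  obtain ⟨f, hfC, hf⟩ := exists_net_tendsto a hg hC
  refine ⟨f, hfC, hf, tendsto_inner_of_tendsto_inner_self fun x => ?_⟩
  rw [inner_borelFC a hg hC]
  have h := (Complex.continuous_ofReal.tendsto _).comp (tendsto_integral_of_tendsto hg hC (hf x))
  exact h.congr fun i => (inner_cfc a x (f i).continuous).symm

theorem isSelfAdjoint_of_inner_real {T : H →L[ℂ] H} {Q : H → ℝ}
    (h : ∀ x, inner ℂ x (T x) = (Q x : ℂ)) : IsSelfAdjoint T := by
  refine eq_of_forall_inner_self_eq fun x => ?_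
  rw [ContinuousLinearMap.star_eq_adjoint, ContinuousLinearMap.adjoint_inner_right,
    ← inner_conj_symm, h, Complex.conj_ofReal]

theorem isSelfAdjoint_borelFC (a : H →L[ℂ] H) {g : ℝ → ℝ} (hg : Measurable g) {C : ℝ}
    (hC : ∀ t, |g t| ≤ C) : IsSelfAdjoint (borelFC a g) :=
  isSelfAdjoint_of_inner_real fun x => inner_borelFC a hg hC x

theorem commute_borelFC {a u : H →L[ℂ] H} (hu : Commute a u) {g : ℝ → ℝ}
    (hg : Measurable g) {C : ℝ} (hC : ∀ t, |g t| ≤ C) : Commute (borelFC a g) u := by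
  obtain ⟨f, -, -, hf⟩ := exists_net_tendsto_borelFC a hg hC
  have := atTop_finset_prod_nat_neBot (H := H)
  refine ContinuousLinearMap.ext fun y => ext_inner_left ℂ fun x => ?_
  refine tendsto_nhds_unique (hf x (u y)) ?_
  have h := hf (ContinuousLinearMap.adjoint u x) y
  simp only [ContinuousLinearMap.adjoint_inner_left] at h
  refine h.congr fun i => ?_
  have hc : Commute (cfc (fun t => f i t) a) u := hu.cfc_real _
  exact congrArg (inner ℂ x) (DFunLike.congr_fun hc.eq y).symm

/-- Multiplicativity when one factor is continuous; `borelFC_mul` follows by approximating that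
factor. -/
theorem inner_cfc_borelFC (a : H →L[ℂ] H) (f : C_c(ℝ, ℝ)) {g : ℝ → ℝ} (hg : Measurable g)
    {C D : ℝ} (hC : ∀ t, |g t| ≤ C) (hD : ∀ t, |f t| ≤ D) (x : H) :
    inner ℂ x (cfc (fun t => f t) a (borelFC a g x)) =
      ((∫ t, f t * g t ∂(spectralMeasure a x) : ℝ) : ℂ) := by
  obtain ⟨k, -, hk1, hk⟩ := exists_net_tendsto_borelFC a hg hC
  have := atTop_finset_prod_nat_neBot (H := H)
  have hsa : IsSelfAdjoint (cfc (fun t => f t) a) := cfc_predicate _ a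
  have hin : ∀ z, inner ℂ x (cfc (fun t => f t) a z) = inner ℂ (cfc (fun t => f t) a x) z :=
    fun z => (hsa.isSymmetric x z).symm
  rw [hin]
  refine tendsto_nhds_unique (hk _ x) ?_
  have h := (Complex.continuous_ofReal.tendsto _).comp
    (tendsto_integral_mul_of_tendsto hg hC f.continuous.measurable hD (hk1 x))
  refine h.congr fun i => ?_
  rw [← hin]
  have hm := cfc_mul (fun t => f t) (fun t => k i t) a f.continuous.continuousOn
    (k i).continuous.continuousOn
  have h' := inner_cfc a x (g := fun t => f t * k i t) (f.continuous.mul (k i).continuous)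
  rw [hm] at h'
  exact h'.symm

theorem borelFC_mul (a : H →L[ℂ] H) {g h : ℝ → ℝ} (hg : Measurable g) (hh : Measurable h)
    {C D : ℝ} (hC : ∀ t, |g t| ≤ C) (hD : ∀ t, |h t| ≤ D) :
    borelFC a (fun t => g t * h t) = borelFC a g * borelFC a h := by
  refine borelFC_eq fun x => ?_
  obtain ⟨k, hkC, hk1, hk⟩ := exists_net_tendsto_borelFC a hg hC
  have := atTop_finset_prod_nat_neBot (H := H)
  refine tendsto_nhds_unique (hk x (borelFC a h x)) ?_
  have hl := (Complex.continuous_ofReal.tendsto _).comp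
    (tendsto_integral_mul_of_tendsto hg hC hh hD (hk1 x))
  simp only [mul_comm (h _)] at hl
  exact hl.congr fun i => (inner_cfc_borelFC a (k i) hh hD (hkC i) x).symm

theorem borelFC_add (a : H →L[ℂ] H) {g h : ℝ → ℝ} (hg : Measurable g) (hh : Measurable h)
    {C D : ℝ} (hC : ∀ t, |g t| ≤ C) (hD : ∀ t, |h t| ≤ D) :
    borelFC a (fun t => g t + h t) = borelFC a g + borelFC a h := by
  refine borelFC_eq fun x => ?_
  rw [add_apply, inner_add_right, inner_borelFC a hg hC, inner_borelFC a hh hD,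
    integral_add (integrable_of_bounded hg hC) (integrable_of_bounded hh hD), Complex.ofReal_add]

theorem borelFC_const_mul (a : H →L[ℂ] H) {g : ℝ → ℝ} (hg : Measurable g) {C : ℝ}
    (hC : ∀ t, |g t| ≤ C) (c : ℝ) :
    borelFC a (fun t => c * g t) = (c : ℂ) • borelFC a g := by
  refine borelFC_eq fun x => ?_
  rw [smul_apply, inner_smul_right, inner_borelFC a hg hC, integral_const_mul, Complex.ofReal_mul]

theorem borelFC_one {a : H →L[ℂ] H} (ha : IsSelfAdjoint a) : borelFC a (fun _ => 1) = 1 := by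
  refine borelFC_eq fun x => ?_
  rw [integral_const, spectralMeasure_real_univ ha, one_apply_eq_self, inner_self_eq_norm_sq_to_K]
  simp

theorem borelFC_congr_ae {a : H →L[ℂ] H} {g h : ℝ → ℝ}
    (hgh : ∀ x, g =ᵐ[spectralMeasure a x] h) : borelFC a g = borelFC a h := by
  classical
  exact congrArg (fun Q : H → ℝ => if h : ∃ T : H →L[ℂ] H, ∀ x, inner ℂ x (T x) = (Q x : ℂ)
    then h.choose else 0) (funext fun x => integral_congr_ae (hgh x))

theorem borelFC_congr {a : H →L[ℂ] H} {g h : ℝ → ℝ} (hgh : EqOn g h (spectrum ℝ a)) :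
    borelFC a g = borelFC a h :=
  borelFC_congr_ae fun x => by
    filter_upwards [ae_mem_spectrum a x] with t ht using hgh ht

theorem borelFC_id {a : H →L[ℂ] H} (ha : IsSelfAdjoint a) : borelFC a (fun t => t) = a :=
  borelFC_eq (inner_apply_eq_integral_id ha)

theorem le_of_forall_inner_re_le {S T : H →L[ℂ] H} (hS : IsSelfAdjoint S) (hT : IsSelfAdjoint T)
    (h : ∀ x, (inner ℂ x (S x)).re ≤ (inner ℂ x (T x)).re) : S ≤ T := by
  rw [ContinuousLinearMap.le_def, ContinuousLinearMap.isPositive_iff']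
  refine ⟨hT.sub hS, fun x => ?_⟩
  rw [show inner ℂ ((T - S) x) x = inner ℂ x ((T - S) x) from (hT.sub hS).isSymmetric x x,
    inner_apply_self_of_isSelfAdjoint (hT.sub hS),
    Complex.zero_le_real, sub_apply, inner_sub_right, Complex.sub_re]
  linarith [h x]

theorem inner_re_le_of_le {S T : H →L[ℂ] H} (h : S ≤ T) (x : H) :
    (inner ℂ x (S x)).re ≤ (inner ℂ x (T x)).re := by
  have h2 := ((ContinuousLinearMap.le_def _ _).1 h).inner_nonneg_right x
  rw [sub_apply, inner_sub_right] at h2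
  simpa using (Complex.le_def.1 h2).1

theorem inner_borelFC_re (a : H →L[ℂ] H) {g : ℝ → ℝ} (hg : Measurable g) {C : ℝ}
    (hC : ∀ t, |g t| ≤ C) (x : H) :
    (inner ℂ x (borelFC a g x)).re = ∫ t, g t ∂(spectralMeasure a x) := by
  rw [inner_borelFC a hg hC, Complex.ofReal_re]

theorem borelFC_mono (a : H →L[ℂ] H) {g h : ℝ → ℝ} (hg : Measurable g) (hh : Measurable h)
    {C D : ℝ} (hC : ∀ t, |g t| ≤ C) (hD : ∀ t, |h t| ≤ D) (hgh : ∀ t ∈ spectrum ℝ a, g t ≤ h t) :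
    borelFC a g ≤ borelFC a h := by
  refine le_of_forall_inner_re_le (isSelfAdjoint_borelFC a hg hC) (isSelfAdjoint_borelFC a hh hD)
    fun x => ?_
  rw [inner_borelFC_re a hg hC, inner_borelFC_re a hh hD]
  refine integral_mono_ae (integrable_of_bounded hg hC) (integrable_of_bounded hh hD) ?_
  filter_upwards [ae_mem_spectrum a x] with t ht using hgh t ht

theorem borelFC_nonneg (a : H →L[ℂ] H) {g : ℝ → ℝ} (hg : Measurable g) {C : ℝ}
    (hC : ∀ t, |g t| ≤ C) (h0 : ∀ t ∈ spectrum ℝ a, 0 ≤ g t) : 0 ≤ borelFC a g := by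
  have h := borelFC_mono a measurable_const hg (g := fun _ => 0) (C := 0) (by simp) hC h0
  rwa [show borelFC a (fun _ => 0) = 0 from borelFC_eq fun x => by simp] at h

theorem norm_apply_borelFC_sq (a : H →L[ℂ] H) {g : ℝ → ℝ} (hg : Measurable g) {C : ℝ}
    (hC : ∀ t, |g t| ≤ C) (x : H) :
    ‖borelFC a g x‖ ^ 2 = ∫ t, g t * g t ∂(spectralMeasure a x) := by
  have hCC : ∀ t, |g t * g t| ≤ C * C := fun t => by
    rw [abs_mul]
    exact mul_le_mul (hC t) (hC t) (abs_nonneg _) ((abs_nonneg _).trans (hC t))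
  rw [← inner_borelFC_re a (g := fun t => g t * g t) (hg.mul hg) hCC,
    borelFC_mul a hg hg hC hC, mul_apply_eq_comp,
    show inner ℂ x (borelFC a g (borelFC a g x)) = inner ℂ (borelFC a g x) (borelFC a g x) from
      ((isSelfAdjoint_borelFC a hg hC).isSymmetric x (borelFC a g x)).symm,
    inner_self_eq_norm_sq_to_K]
  simp [← Complex.ofReal_pow]

theorem norm_borelFC_le {a : H →L[ℂ] H} (ha : IsSelfAdjoint a) {g : ℝ → ℝ} (hg : Measurable g)
    {C D : ℝ} (hC : ∀ t, |g t| ≤ C) (hD0 : 0 ≤ D) (hD : ∀ t ∈ spectrum ℝ a, |g t| ≤ D) :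
    ‖borelFC a g‖ ≤ D := by
  refine ContinuousLinearMap.opNorm_le_bound _ hD0 fun x => ?_
  refine abs_le_of_sq_le_sq' ?_ (by positivity) |>.2
  rw [norm_apply_borelFC_sq a hg hC, mul_pow, ← spectralMeasure_real_univ ha]
  have hCC : ∀ t, |g t * g t| ≤ C * C := fun t => by
    rw [abs_mul]
    exact mul_le_mul (hC t) (hC t) (abs_nonneg _) ((abs_nonneg _).trans (hC t))
  calc ∫ t, g t * g t ∂(spectralMeasure a x) ≤ ∫ _, D ^ 2 ∂(spectralMeasure a x) := by
        refine integral_mono_ae (integrable_of_bounded (hg.mul hg) hCC) (integrable_const _) ?_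
        filter_upwards [ae_mem_spectrum a x] with t ht
        rw [← abs_mul_abs_self, ← pow_two]
        exact pow_le_pow_left₀ (abs_nonneg _) (hD t ht) 2
    _ = D ^ 2 * (spectralMeasure a x).real univ := by
        rw [integral_const, smul_eq_mul, mul_comm]

/-! ### Composition of Borel functions -/

theorem abs_le_norm_of_mem_spectrum {a : H →L[ℂ] H} {t : ℝ} (ht : t ∈ spectrum ℝ a) :
    |t| ≤ ‖a‖ := by
  rcases subsingleton_or_nontrivial H with h | h
  · simp [spectrum.of_subsingleton] at ht
  · exact spectrum.norm_le_norm_of_mem ht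

theorem exists_bound_comp {g k : ℝ → ℝ} (hk : Continuous k) {C : ℝ} (hC : ∀ t, |g t| ≤ C) :
    ∃ D, ∀ t, |k (g t)| ≤ D := by
  obtain ⟨D, hD⟩ := isCompact_Icc.exists_bound_of_continuousOn (s := Icc (-C) C) hk.continuousOn
  exact ⟨D, fun t => hD _ (abs_le.1 (hC t))⟩

/-- The composition rule for polynomials, from which the general one is obtained by the
Weierstrass approximation theorem. -/
theorem aeval_borelFC {a : H →L[ℂ] H} (ha : IsSelfAdjoint a) {g : ℝ → ℝ} (hg : Measurable g)
    {C : ℝ} (hC : ∀ t, |g t| ≤ C) (p : Polynomial ℝ) :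
    Polynomial.aeval (borelFC a g) p = borelFC a (fun t => p.eval (g t)) := by
  induction p using Polynomial.induction_on' with
  | add p q hp hq =>
    obtain ⟨D, hD⟩ := exists_bound_comp p.continuous hC
    obtain ⟨E, hE⟩ := exists_bound_comp q.continuous hC
    simp only [map_add, Polynomial.eval_add, hp, hq]
    exact (borelFC_add a (p.continuous.measurable.comp hg) (q.continuous.measurable.comp hg)
      hD hE).symm
  | monomial n c =>
    have hpow : ∀ n : ℕ, borelFC a (fun t => g t ^ n) = borelFC a g ^ n := by
      intro n
      induction n with
      | zero => simpa using borelFC_one ha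
      | succ n ih =>
        obtain ⟨D, hD⟩ := exists_bound_comp (continuous_pow n) hC
        simp only [pow_succ]
        rw [borelFC_mul a (hg.pow_const n) hg hD hC, ih]
    obtain ⟨D, hD⟩ := exists_bound_comp (continuous_pow n) hC
    simp only [Polynomial.aeval_monomial, Polynomial.eval_monomial]
    rw [borelFC_const_mul a (hg.pow_const n) hD, hpow, Algebra.algebraMap_eq_smul_one,
      smul_mul_assoc, one_mul]
    rfl

/-- The scalar spectral measures of `g(a)` are the push-forwards under `g` of those of `a`. -/
theorem spectralMeasure_borelFC {a : H →L[ℂ] H} (ha : IsSelfAdjoint a) {g : ℝ → ℝ}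
    (hg : Measurable g) {C : ℝ} (hC : ∀ t, |g t| ≤ C) (x : H) :
    spectralMeasure (borelFC a g) x = (spectralMeasure a x).map g := by
  set y := borelFC a g with hy
  have hysa : IsSelfAdjoint y := isSelfAdjoint_borelFC a hg hC
  have hyC : ‖y‖ ≤ C := norm_borelFC_le ha hg hC ((abs_nonneg _).trans (hC 0)) fun t _ => hC t
  refine Measure.ext_of_integral_eq_on_compactlySupported fun f => ?_
  have hmap : ∫ t, f t ∂((spectralMeasure a x).map g) = ∫ t, f (g t) ∂(spectralMeasure a x) :=
    integral_map hg.aemeasurable f.continuous.aestronglyMeasurable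
  rw [hmap]
  refine eq_of_forall_dist_le fun ε hε => ?_
  have hδ : 0 < ε / (2 * (‖x‖ ^ 2 + 1)) := by positivity
  obtain ⟨p, hp⟩ := exists_polynomial_near_of_continuousOn (-C) C f f.continuous.continuousOn _ hδ
  have hp1 : ∫ t, p.eval t ∂(spectralMeasure y x) = ∫ t, p.eval (g t) ∂(spectralMeasure a x) := by
    obtain ⟨D, hD⟩ := exists_bound_comp p.continuous hC
    rw [integral_spectralMeasure_of_continuous y x p.continuous, cfc_polynomial p y,
      aeval_borelFC ha hg hC]
    exact inner_borelFC_re a (p.continuous.measurable.comp hg) hD x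
  obtain ⟨D, hD⟩ := exists_bound_comp p.continuous hC
  obtain ⟨E, hE⟩ := exists_bound_comp f.continuous hC
  have hfi : Integrable (fun t => f t) (spectralMeasure y x) :=
    f.continuous.integrable_of_hasCompactSupport f.hasCompactSupport
  have hfg : Integrable (fun t => f (g t)) (spectralMeasure a x) :=
    .of_bound (f.continuous.measurable.comp hg).aestronglyMeasurable E (ae_of_all _ hE)
  have hpg : Integrable (fun t => p.eval (g t)) (spectralMeasure a x) :=
    .of_bound (p.continuous.measurable.comp hg).aestronglyMeasurable D (ae_of_all _ hD)
  have h1 : |∫ t, f t ∂(spectralMeasure y x) - ∫ t, p.eval t ∂(spectralMeasure y x)| ≤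
      ε / (2 * (‖x‖ ^ 2 + 1)) * ‖x‖ ^ 2 := by
    have hpi : Integrable (fun t => p.eval t) (spectralMeasure y x) := by
      obtain ⟨D, hD⟩ := isCompact_Icc.exists_bound_of_continuousOn (s := Icc (-C) C)
        p.continuous.continuousOn
      refine Integrable.of_bound p.continuous.measurable.aestronglyMeasurable D ?_
      filter_upwards [ae_mem_spectrum y x] with t ht
      exact hD t (abs_le.1 ((abs_le_norm_of_mem_spectrum ht).trans hyC))
    rw [← integral_sub hfi hpi, ← Real.norm_eq_abs]
    refine (norm_integral_le_of_norm_le_const (C := ε / (2 * (‖x‖ ^ 2 + 1))) ?_).trans_eq ?_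
    · filter_upwards [ae_mem_spectrum y x] with t ht
      rw [norm_sub_rev]
      exact (hp t (abs_le.1 ((abs_le_norm_of_mem_spectrum ht).trans hyC))).le
    · rw [spectralMeasure_real_univ hysa x]
  have h2 : |∫ t, f (g t) ∂(spectralMeasure a x) - ∫ t, p.eval (g t) ∂(spectralMeasure a x)| ≤
      ε / (2 * (‖x‖ ^ 2 + 1)) * ‖x‖ ^ 2 := by
    rw [← integral_sub hfg hpg, ← Real.norm_eq_abs]
    refine (norm_integral_le_of_norm_le_const (C := ε / (2 * (‖x‖ ^ 2 + 1))) ?_).trans_eq ?_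
    · filter_upwards with t
      rw [norm_sub_rev]
      exact (hp _ (abs_le.1 (hC t))).le
    · rw [spectralMeasure_real_univ ha x]
  have h3 : ε / (2 * (‖x‖ ^ 2 + 1)) * ‖x‖ ^ 2 ≤ ε / 2 := by
    rw [div_mul_eq_mul_div, div_le_div_iff₀ (by positivity) (by positivity)]
    nlinarith
  rw [Real.dist_eq]
  rw [abs_le] at h1 h2 ⊢
  constructor <;> linarith [h1.1, h1.2, h2.1, h2.2]

/-! ### Spectral projections -/

theorem measurable_indicator_one {Δ : Set ℝ} (hΔ : MeasurableSet Δ) :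
    Measurable (Δ.indicator fun _ => (1 : ℝ)) :=
  measurable_const.indicator hΔ

theorem abs_indicator_one_le (Δ : Set ℝ) (t : ℝ) : |Δ.indicator (fun _ => (1 : ℝ)) t| ≤ 1 := by
  by_cases h : t ∈ Δ <;> simp [h]

theorem isSelfAdjoint_of_nonneg {a : H →L[ℂ] H} (ha : 0 ≤ a) : IsSelfAdjoint a :=
  ((ContinuousLinearMap.nonneg_iff_isPositive a).1 ha).isSelfAdjoint

theorem mem_Icc_of_mem_spectrum {a : H →L[ℂ] H} (ha : 0 ≤ a) {t : ℝ} (ht : t ∈ spectrum ℝ a) :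
    t ∈ Icc 0 ‖a‖ :=
  ⟨spectrum_nonneg_of_nonneg ha ht, (le_abs_self t).trans (abs_le_norm_of_mem_spectrum ht)⟩

theorem inner_spectralProj_re (a : H →L[ℂ] H) {Δ : Set ℝ} (hΔ : MeasurableSet Δ) (x : H) :
    (inner ℂ x (spectralProj a Δ x)).re = (spectralMeasure a x).real Δ := by
  rw [spectralProj, inner_borelFC_re a (measurable_indicator_one hΔ) (abs_indicator_one_le Δ)]
  simp [integral_indicator_const _ hΔ]

theorem isStarProjection_spectralProj (a : H →L[ℂ] H) {Δ : Set ℝ} (hΔ : MeasurableSet Δ) :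
    IsStarProjection (spectralProj a Δ) := by
  refine ⟨?_, isSelfAdjoint_borelFC a (measurable_indicator_one hΔ) (abs_indicator_one_le Δ)⟩
  have h := borelFC_mul a (measurable_indicator_one hΔ) (measurable_indicator_one hΔ)
    (abs_indicator_one_le Δ) (abs_indicator_one_le Δ)
  rw [IsIdempotentElem, spectralProj, ← h]
  congr 1
  ext t
  by_cases ht : t ∈ Δ <;> simp [ht]

theorem spectralProj_congr {a : H →L[ℂ] H} {Δ Δ' : Set ℝ}
    (h : ∀ t ∈ spectrum ℝ a, t ∈ Δ ↔ t ∈ Δ') : spectralProj a Δ = spectralProj a Δ' :=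
  borelFC_congr fun t ht => by
    by_cases h' : t ∈ Δ
    · simp [h', (h t ht).1 h']
    · simp [h', mt (h t ht).2 h']

theorem spectralProj_le_of_forall_mem_spectrum (a : H →L[ℂ] H) {Δ Δ' : Set ℝ}
    (hΔ : MeasurableSet Δ) (hΔ' : MeasurableSet Δ') (h : ∀ t ∈ spectrum ℝ a, t ∈ Δ → t ∈ Δ') :
    spectralProj a Δ ≤ spectralProj a Δ' :=
  borelFC_mono a (measurable_indicator_one hΔ) (measurable_indicator_one hΔ')
    (abs_indicator_one_le Δ) (abs_indicator_one_le Δ') fun t ht => by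
      by_cases h' : t ∈ Δ
      · simp [h', h t ht h']
      · simp only [h', not_false_eq_true, indicator_of_notMem]
        exact indicator_nonneg (fun _ _ => zero_le_one) t

theorem spectralProj_mono (a : H →L[ℂ] H) {Δ Δ' : Set ℝ} (hΔ : MeasurableSet Δ)
    (hΔ' : MeasurableSet Δ') (h : Δ ⊆ Δ') : spectralProj a Δ ≤ spectralProj a Δ' :=
  spectralProj_le_of_forall_mem_spectrum a hΔ hΔ' fun _ _ ht => h ht

theorem spectralProj_empty (a : H →L[ℂ] H) : spectralProj a ∅ = 0 :=
  borelFC_eq fun x => by simp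

theorem spectralProj_univ {a : H →L[ℂ] H} (ha : IsSelfAdjoint a) : spectralProj a univ = 1 := by
  simp only [spectralProj, indicator_univ]
  exact borelFC_one ha

theorem spectralProj_compl {a : H →L[ℂ] H} (ha : IsSelfAdjoint a) {Δ : Set ℝ}
    (hΔ : MeasurableSet Δ) : spectralProj a Δᶜ = 1 - spectralProj a Δ := by
  have h := borelFC_add a (measurable_indicator_one hΔ) (measurable_indicator_one hΔ.compl)
    (abs_indicator_one_le Δ) (abs_indicator_one_le Δᶜ)
  rw [eq_sub_iff_add_eq', spectralProj, spectralProj, ← h, ← borelFC_one ha]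
  congr 1
  ext t
  by_cases ht : t ∈ Δ <;> simp [ht]

theorem spectralProj_borelFC {a : H →L[ℂ] H} (ha : IsSelfAdjoint a) {g : ℝ → ℝ}
    (hg : Measurable g) {C : ℝ} (hC : ∀ t, |g t| ≤ C) {Δ : Set ℝ} (hΔ : MeasurableSet Δ) :
    spectralProj (borelFC a g) Δ = spectralProj a (g ⁻¹' Δ) := by
  refine borelFC_eq fun x => ?_
  rw [spectralProj, inner_borelFC a (measurable_indicator_one (hg hΔ)) (abs_indicator_one_le _),
    spectralMeasure_borelFC ha hg hC, integral_map hg.aemeasurable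
      (measurable_indicator_one hΔ).aestronglyMeasurable]
  rfl

theorem spectralProj_Ioi_of_norm_le {a : H →L[ℂ] H} {s : ℝ} (hs : ‖a‖ ≤ s) :
    spectralProj a (Ioi s) = 0 := by
  rw [← spectralProj_empty a]
  refine spectralProj_congr fun t ht => ?_
  have := (le_abs_self t).trans (abs_le_norm_of_mem_spectrum ht)
  simp only [mem_Ioi, mem_empty_iff_false, iff_false, not_lt]
  linarith

theorem borelFC_clamp {a : H →L[ℂ] H} (ha : 0 ≤ a) :
    borelFC a (fun t => max 0 (min t ‖a‖)) = a := by
  conv_rhs => rw [← borelFC_id (isSelfAdjoint_of_nonneg ha)]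
  refine borelFC_congr fun t ht => ?_
  have h := mem_Icc_of_mem_spectrum ha ht
  simp only [min_eq_left h.2, max_eq_right h.1]

theorem abs_clamp_le {C : ℝ} (hC : 0 ≤ C) (t : ℝ) : |max 0 (min t C)| ≤ C := by
  rw [abs_of_nonneg (le_max_left _ _)]
  exact max_le hC (min_le_right _ _)

theorem measurable_clamp (C : ℝ) : Measurable fun t : ℝ => max 0 (min t C) := by
  fun_prop

theorem tendsto_measureReal_Ioi (μ : Measure ℝ) [IsFiniteMeasure μ] (s : ℝ) :
    Tendsto (fun n : ℕ => μ.real (Ioi (s + 1 / ((n : ℝ) + 1)))) atTop (𝓝 (μ.real (Ioi s))) := by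
  have hU : ⋃ n : ℕ, Ioi (s + 1 / ((n : ℝ) + 1)) = Ioi s := by
    ext t
    simp only [mem_iUnion, mem_Ioi]
    constructor
    · rintro ⟨n, hn⟩
      have : (0 : ℝ) < 1 / ((n : ℝ) + 1) := by positivity
      linarith
    · intro ht
      obtain ⟨n, hn⟩ := exists_nat_one_div_lt (sub_pos.2 ht)
      exact ⟨n, by linarith⟩
  have hm : Monotone fun n : ℕ => Ioi (s + 1 / ((n : ℝ) + 1)) := fun m n hmn =>
    Ioi_subset_Ioi (by gcongr)
  have h := tendsto_measure_iUnion_atTop (μ := μ) hm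
  rw [hU] at h
  exact (ENNReal.tendsto_toReal (measure_ne_top _ _)).comp h

/-- A positive operator is determined by its spectral projections of the half-lines `(s, ∞)`,
`s ≥ 0`. -/
theorem eq_of_forall_spectralProj_Ioi_eq {x y : H →L[ℂ] H} (hx : 0 ≤ x) (hy : 0 ≤ y)
    (h : ∀ s, 0 ≤ s → spectralProj x (Ioi s) = spectralProj y (Ioi s)) : x = y := by
  have hx' := isSelfAdjoint_of_nonneg hx
  have hy' := isSelfAdjoint_of_nonneg hy
  have hneg : ∀ {z : H →L[ℂ] H}, 0 ≤ z → ∀ s < 0, spectralProj z (Ioi s) = 1 := by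
    intro z hz s hs
    rw [← spectralProj_univ (isSelfAdjoint_of_nonneg hz)]
    refine spectralProj_congr fun t ht => ?_
    have := (mem_Icc_of_mem_spectrum hz ht).1
    simp only [mem_Ioi, mem_univ, iff_true]
    linarith
  have hall : ∀ s, spectralProj x (Ioi s) = spectralProj y (Ioi s) := fun s => by
    rcases lt_or_ge s 0 with hs | hs
    · rw [hneg hx s hs, hneg hy s hs]
    · exact h s hs
  have hμ : ∀ v, spectralMeasure x v = spectralMeasure y v := fun v => by
    refine Measure.ext_of_Iic _ _ fun s => ?_
    have hr : (spectralMeasure x v).real (Iic s) = (spectralMeasure y v).real (Iic s) := by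
      rw [← inner_spectralProj_re x measurableSet_Iic, ← inner_spectralProj_re y measurableSet_Iic,
        ← compl_Ioi, spectralProj_compl hx' measurableSet_Ioi,
        spectralProj_compl hy' measurableSet_Ioi, hall s]
    exact (measureReal_eq_measureReal_iff).1 hr
  refine eq_of_forall_inner_self_eq fun v => ?_
  rw [inner_apply_eq_integral_id hx', inner_apply_eq_integral_id hy', hμ]

/-! ### Functional calculus inside a von Neumann algebra -/

variable {M : VonNeumannAlgebra H}

theorem mem_of_forall_commute {T : H →L[ℂ] H} (h : ∀ u ∈ M.commutant, Commute T u) : T ∈ M := by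
  rw [← M.commutant_commutant, VonNeumannAlgebra.mem_commutant_iff]
  exact fun u hu => (h u hu).eq.symm

theorem commute_of_mem_commutant {a u : H →L[ℂ] H} (ha : a ∈ M) (hu : u ∈ M.commutant) :
    Commute a u :=
  VonNeumannAlgebra.mem_commutant_iff.1 hu a ha

theorem borelFC_mem {a : H →L[ℂ] H} (ha : a ∈ M) {g : ℝ → ℝ}
    (hg : Measurable g) {C : ℝ} (hC : ∀ t, |g t| ≤ C) : borelFC a g ∈ M :=
  mem_of_forall_commute fun _ hu => commute_borelFC (commute_of_mem_commutant ha hu) hg hC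

theorem spectralProj_mem {a : H →L[ℂ] H} (ha : a ∈ M) {Δ : Set ℝ} (hΔ : MeasurableSet Δ) :
    spectralProj a Δ ∈ M :=
  borelFC_mem ha (measurable_indicator_one hΔ) (abs_indicator_one_le Δ)

theorem units_inv_mem {u : (H →L[ℂ] H)ˣ} (hu : (u : H →L[ℂ] H) ∈ M) :
    ((u⁻¹ : (H →L[ℂ] H)ˣ) : H →L[ℂ] H) ∈ M :=
  mem_of_forall_commute fun _ hv => (commute_of_mem_commutant hu hv).units_inv_left

theorem smul_mem {x : H →L[ℂ] H} (hx : x ∈ M) (c : ℂ) : c • x ∈ M :=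
  M.toStarSubalgebra.smul_mem hx c

/-! ### The trace -/

variable {τ : (H →L[ℂ] H) → ℂ}

theorem IsNormalizedTrace.map_sub (hτ : IsNormalizedTrace M τ) {x y : H →L[ℂ] H} (hx : x ∈ M)
    (hy : y ∈ M) : τ (x - y) = τ x - τ y := by
  have h := hτ.map_add (x - y) (sub_mem hx hy) y hy
  rw [sub_add_cancel] at h
  rw [h, add_sub_cancel_right]

theorem IsNormalizedTrace.mono (hτ : IsNormalizedTrace M τ) {x y : H →L[ℂ] H} (hx : x ∈ M)
    (hy : y ∈ M) (hxy : x ≤ y) : (τ x).re ≤ (τ y).re := by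
  have h := (hτ.nonneg (y - x) (sub_mem hy hx) (sub_nonneg.2 hxy)).1
  rw [hτ.map_sub hy hx, Complex.sub_re] at h
  linarith

theorem IsNormalizedTrace.eq_of_le (hτ : IsNormalizedTrace M τ) {x y : H →L[ℂ] H} (hx : x ∈ M)
    (hy : y ∈ M) (hxy : x ≤ y) (h : (τ y).re ≤ (τ x).re) : x = y := by
  have h0 := sub_nonneg.2 hxy
  have hn := hτ.nonneg (y - x) (sub_mem hy hx) h0
  refine (sub_eq_zero.1 (hτ.faithful (y - x) (sub_mem hy hx) h0 (Complex.ext ?_ hn.2))).symm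
  refine le_antisymm ?_ hn.1
  rw [hτ.map_sub hy hx, Complex.sub_re]
  exact sub_nonpos.2 h

theorem IsNormalizedTrace.map_one_sub (hτ : IsNormalizedTrace M τ) {x : H →L[ℂ] H} (hx : x ∈ M) :
    (τ (1 - x)).re = 1 - (τ x).re := by
  rw [hτ.map_sub (one_mem M) hx, hτ.map_one, Complex.sub_re, Complex.one_re]

/-- Normality for increasing sequences that converge weakly. -/
theorem IsNormalizedTrace.tendsto_of_monotone (hτ : IsNormalizedTrace M τ) {E : ℕ → H →L[ℂ] H}
    {F : H →L[ℂ] H} (hE : Monotone E) (hEM : ∀ n, E n ∈ M) (hE0 : ∀ n, 0 ≤ E n) (hFM : F ∈ M)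
    (hF : IsSelfAdjoint F)
    (hlim : ∀ v, Tendsto (fun n => (inner ℂ v (E n v)).re) atTop (𝓝 (inner ℂ v (F v)).re)) :
    Tendsto (fun n => (τ (E n)).re) atTop (𝓝 (τ F).re) := by
  have hLUB : IsLUB (range E) F := by
    constructor
    · rintro _ ⟨n, rfl⟩
      refine le_of_forall_inner_re_le (isSelfAdjoint_of_nonneg (hE0 n)) hF fun v => ?_
      exact Monotone.ge_of_tendsto (fun m n hmn => inner_re_le_of_le (hE hmn) v) (hlim v) n
    · intro T hT
      have hT0 : 0 ≤ T := (hE0 0).trans (hT ⟨0, rfl⟩)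
      refine le_of_forall_inner_re_le hF (isSelfAdjoint_of_nonneg hT0) fun v => ?_
      exact le_of_tendsto (hlim v) (Eventually.of_forall fun n => inner_re_le_of_le (hT ⟨n, rfl⟩) v)
  have h := hτ.normal (range E) F (range_nonempty E)
    (by rintro _ ⟨n, rfl⟩; exact ⟨hEM n, hE0 n⟩)
    (directedOn_range.2 hE.directed_le) hFM hLUB
  rw [← range_comp] at h
  exact tendsto_atTop_isLUB (fun m n hmn => hτ.mono (hEM m) (hEM n) (hE hmn)) h

/-- The distribution function `s ↦ τ(Pˣ(s, ∞))`. -/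
noncomputable def distribution (τ : (H →L[ℂ] H) → ℂ) (x : H →L[ℂ] H) (s : ℝ) : ℝ :=
  (τ (spectralProj x (Ioi s))).re

theorem distribution_nonneg (hτ : IsNormalizedTrace M τ) {x : H →L[ℂ] H} (hx : x ∈ M) (s : ℝ) :
    0 ≤ distribution τ x s :=
  (hτ.nonneg _ (spectralProj_mem hx measurableSet_Ioi)
    (isStarProjection_spectralProj x measurableSet_Ioi).nonneg).1

theorem distribution_le_one (hτ : IsNormalizedTrace M τ) {x : H →L[ℂ] H} (hx : x ∈ M) (s : ℝ) :
    distribution τ x s ≤ 1 := by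
  have h := hτ.mono (spectralProj_mem hx measurableSet_Ioi) (one_mem M)
    (isStarProjection_spectralProj x (measurableSet_Ioi (a := s))).le_one
  rwa [hτ.map_one] at h

theorem distribution_antitone (hτ : IsNormalizedTrace M τ) {x : H →L[ℂ] H} (hx : x ∈ M) :
    Antitone (distribution τ x) := fun _ _ hst =>
  hτ.mono (spectralProj_mem hx measurableSet_Ioi) (spectralProj_mem hx measurableSet_Ioi)
    (spectralProj_mono x measurableSet_Ioi measurableSet_Ioi (Ioi_subset_Ioi hst))

theorem IsNormalizedTrace.map_zero (hτ : IsNormalizedTrace M τ) : τ 0 = 0 := by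
  have h := hτ.map_smul 0 0 (zero_mem M)
  rwa [zero_smul, zero_mul] at h

theorem distribution_of_norm_le (hτ : IsNormalizedTrace M τ) {x : H →L[ℂ] H} {s : ℝ}
    (hs : ‖x‖ ≤ s) : distribution τ x s = 0 := by
  rw [distribution, spectralProj_Ioi_of_norm_le hs, hτ.map_zero, Complex.zero_re]

theorem tendsto_distribution (hτ : IsNormalizedTrace M τ) {x : H →L[ℂ] H} (hx : x ∈ M) (s : ℝ) :
    Tendsto (fun n : ℕ => distribution τ x (s + 1 / ((n : ℝ) + 1))) atTop
      (𝓝 (distribution τ x s)) := by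
  refine hτ.tendsto_of_monotone (fun m n hmn => ?_)
    (fun n => spectralProj_mem hx measurableSet_Ioi)
    (fun n => (isStarProjection_spectralProj x measurableSet_Ioi).nonneg)
    (spectralProj_mem hx measurableSet_Ioi)
    (isStarProjection_spectralProj x measurableSet_Ioi).isSelfAdjoint fun v => ?_
  · exact spectralProj_mono x measurableSet_Ioi measurableSet_Ioi (Ioi_subset_Ioi (by gcongr))
  · simp only [inner_spectralProj_re x measurableSet_Ioi]
    exact tendsto_measureReal_Ioi _ s

theorem distribution_le_of_forall_gt (hτ : IsNormalizedTrace M τ) {x : H →L[ℂ] H} (hx : x ∈ M)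
    {s t : ℝ} (h : ∀ r > s, distribution τ x r ≤ t) : distribution τ x s ≤ t :=
  le_of_tendsto (tendsto_distribution hτ hx s) <| Eventually.of_forall fun n =>
    h _ (lt_add_of_pos_right s (by positivity))

/-- If `p` and `e` are projections of `M` with `‖p e p‖ < 1`, then `p` is equivalent to a
subprojection of `1 - e`, and so has smaller trace. -/
theorem IsNormalizedTrace.le_of_norm_lt_one (hτ : IsNormalizedTrace M τ) {p e : H →L[ℂ] H}
    (hp : IsStarProjection p) (he : IsStarProjection e) (hpM : p ∈ M) (heM : e ∈ M)
    (h : ‖p * e * p‖ < 1) : (τ p).re ≤ (τ (1 - e)).re := by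
  have hpp : p * p = p := hp.isIdempotentElem
  have hps : star p = p := hp.isSelfAdjoint
  set q := 1 - e with hq
  have hqP : IsStarProjection q := he.one_sub
  have hqq : q * q = q := hqP.isIdempotentElem
  have hqs : star q = q := hqP.isSelfAdjoint
  have hqM : q ∈ M := sub_mem (one_mem M) heM
  set u : (H →L[ℂ] H)ˣ := Units.oneSub (p * e * p) h with hu
  have huv : (u : H →L[ℂ] H) = 1 - p * e * p := rfl
  have huM : (u : H →L[ℂ] H) ∈ M := sub_mem (one_mem M) (mul_mem (mul_mem hpM heM) hpM)
  set g : H →L[ℂ] H := ((u⁻¹ : (H →L[ℂ] H)ˣ) : H →L[ℂ] H) with hg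
  have hgM : g ∈ M := units_inv_mem huM
  -- inside the corner `p M p` the element `p q p` coincides with the invertible element `u`
  have hpqp : p * q * p = p * u := by
    rw [huv, hq, mul_sub p 1 e, mul_one, sub_mul, hpp, mul_sub, mul_one, ← mul_assoc, ← mul_assoc,
      hpp]
  have hcomm : Commute p u := by
    rw [huv]
    refine (Commute.one_right p).sub_right ?_
    change p * (p * e * p) = p * e * p * p
    rw [← mul_assoc, ← mul_assoc, hpp, mul_assoc (p * e), hpp]
  have hpg : Commute p g := hcomm.units_inv_right
  have hug : (u : H →L[ℂ] H) * g = 1 := u.mul_inv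
  have hpqpg : p * q * p * g = p := by rw [hpqp, mul_assoc, hug, mul_one]
  have hus : star (u : H →L[ℂ] H) = u := by
    rw [huv, star_sub, star_one, star_mul, star_mul, hps, he.isSelfAdjoint.star_eq, mul_assoc]
  have hgs : star g = g := by
    have h1 : star g * u = 1 := by rw [← hus, ← star_mul, hug, star_one]
    calc star g = star g * (u * g) := by rw [hug, mul_one]
      _ = g := by rw [← mul_assoc, h1, one_mul]
  -- `f` is the projection onto the range of `q p`, and `g` plays the role of `(p q p)⁻¹`
  set f := q * p * g * p * q with hf
  have hfM : f ∈ M := mul_mem (mul_mem (mul_mem (mul_mem hqM hpM) hgM) hpM) hqM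
  have hfs : star f = f := by
    simp only [hf, star_mul, hps, hqs, hgs, mul_assoc]
  have hff : f * f = f := by
    calc f * f = q * p * g * (p * (q * q) * p * g) * p * q := by simp only [hf, mul_assoc]
      _ = q * p * g * p * p * q := by rw [hqq, hpqpg]
      _ = f := by rw [mul_assoc (q * p * g), hpp]
  have hqf : q * f = f := by
    calc q * f = (q * q) * p * g * p * q := by simp only [hf, mul_assoc]
      _ = f := by rw [hqq]
  have hfq : f * q = f := by rw [hf, mul_assoc _ q q, hqq]
  have hfle : f ≤ q := by
    have hP : IsStarProjection (q - f) := by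
      refine ⟨?_, ?_⟩
      · rw [IsIdempotentElem, sub_mul, mul_sub q q f, mul_sub f q f, hqq, hqf, hfq, hff, sub_self,
          sub_zero]
      · rw [IsSelfAdjoint, star_sub, hqs, hfs]
    exact sub_nonneg.1 hP.nonneg
  have hτf : τ f = τ p := by
    have h1 : f = (q * p * g) * (p * q) := by simp only [hf, mul_assoc]
    rw [h1, hτ.tracial _ (mul_mem (mul_mem hqM hpM) hgM) _ (mul_mem hpM hqM)]
    have h2 : p * q * (q * p * g) = p * (q * q) * p * g := by simp only [mul_assoc]
    rw [h2, hqq, hpqpg]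
  rw [← hτf]
  exact hτ.mono hfM hqM hfle

/-! ### Singular values of positive operators -/

/-- The lower bound for singular values: if `x` is smaller than `r` on the range of `e`, then
`Pˣ(r, ∞)` is at most as large as `1 - e`. -/
theorem distribution_le_of_norm_mul_lt (hτ : IsNormalizedTrace M τ) {x e : H →L[ℂ] H}
    (hx : x ∈ M) (hx0 : 0 ≤ x) (he : IsStarProjection e) (heM : e ∈ M) {r : ℝ}
    (hr : ‖x * e‖ < r) : distribution τ x r ≤ (τ (1 - e)).re := by
  have hr0 : 0 < r := (norm_nonneg _).trans_lt hr
  set p := spectralProj x (Ioi r) with hp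
  have hpP : IsStarProjection p := isStarProjection_spectralProj x measurableSet_Ioi
  refine hτ.le_of_norm_lt_one hpP he (spectralProj_mem hx measurableSet_Ioi) heM ?_
  set c : ℝ → ℝ := fun t => max 0 (min t ‖x‖) with hc
  have hcm : Measurable c := measurable_clamp _
  have hcb : ∀ t, |c t| ≤ ‖x‖ := abs_clamp_le (norm_nonneg x)
  have hcx : borelFC x c = x := borelFC_clamp hx0
  -- Chebyshev: `r² Pˣ(r, ∞) ≤ x²`
  have hle : ∀ v, r * ‖p v‖ ≤ ‖x v‖ := fun v => by
    refine abs_le_of_sq_le_sq' ?_ (norm_nonneg _) |>.2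
    have h1 := norm_apply_borelFC_sq x (measurable_indicator_one measurableSet_Ioi)
      (abs_indicator_one_le (Ioi r)) v
    have h2 := norm_apply_borelFC_sq x hcm hcb v
    rw [hcx] at h2
    change ‖p v‖ ^ 2 = _ at h1
    have hCC : ∀ t, |c t * c t| ≤ ‖x‖ * ‖x‖ := fun t => by
      rw [abs_mul]
      exact mul_le_mul (hcb t) (hcb t) (abs_nonneg _) (norm_nonneg x)
    rw [mul_pow, h1, h2, ← integral_const_mul]
    refine integral_mono_ae ((integrable_of_bounded (C := 1) ?_ fun t => ?_).const_mul _)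
      (integrable_of_bounded (hcm.mul hcm) hCC) ?_
    · exact (measurable_indicator_one measurableSet_Ioi).mul
        (measurable_indicator_one measurableSet_Ioi)
    · rw [abs_mul]
      exact mul_le_one₀ (abs_indicator_one_le _ _) (abs_nonneg _) (abs_indicator_one_le _ _)
    · filter_upwards [ae_mem_spectrum x v] with t ht
      have h := mem_Icc_of_mem_spectrum hx0 ht
      have hct : c t = t := by simp only [hc, min_eq_left h.2, max_eq_right h.1]
      rw [hct]
      by_cases htr : r < t
      · have : t ∈ Ioi r := htr
        simp only [this, indicator_of_mem]
        nlinarith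
      · have : t ∉ Ioi r := htr
        simp only [this, not_false_eq_true, indicator_of_notMem]
        nlinarith [h.1]
  have hpe : ‖p * e‖ ≤ ‖x * e‖ / r := by
    refine ContinuousLinearMap.opNorm_le_bound _ (by positivity) fun v => ?_
    have h1 := hle (e v)
    have h2 := (x * e).le_opNorm v
    rw [div_mul_eq_mul_div, le_div_iff₀ hr0, mul_comm]
    exact h1.trans h2
  have hpe1 : ‖p * e‖ < 1 := hpe.trans_lt ((div_lt_one hr0).2 hr)
  have hstar : p * e * p = (p * e) * star (p * e) := by
    rw [star_mul, he.isSelfAdjoint.star_eq, hpP.isSelfAdjoint.star_eq, mul_assoc p e (e * p),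
      ← mul_assoc e e p, he.isIdempotentElem.eq, mul_assoc]
  rw [hstar, CStarRing.norm_self_mul_star]
  exact mul_lt_one_of_nonneg_of_lt_one_left (norm_nonneg _) hpe1 hpe1.le

theorem norm_mul_spectralProj_Iic_le {x : H →L[ℂ] H} (hx : 0 ≤ x) {s : ℝ} (hs : 0 ≤ s) :
    ‖x * spectralProj x (Iic s)‖ ≤ s := by
  set c : ℝ → ℝ := fun t => max 0 (min t ‖x‖) with hc
  have hcm : Measurable c := measurable_clamp _
  have hcb : ∀ t, |c t| ≤ ‖x‖ := abs_clamp_le (norm_nonneg x)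
  have him := measurable_indicator_one (measurableSet_Iic (a := s))
  have h := borelFC_mul x hcm him hcb (abs_indicator_one_le _)
  rw [borelFC_clamp hx] at h
  rw [spectralProj, ← h]
  refine norm_borelFC_le (isSelfAdjoint_of_nonneg hx) (C := ‖x‖)
    (g := fun t => c t * (Iic s).indicator (fun _ => 1) t) (hcm.mul him) (fun t => ?_) hs
    fun t ht => ?_
  · rw [abs_mul]
    exact (mul_le_of_le_one_right (abs_nonneg _) (abs_indicator_one_le _ _)).trans (hcb t)
  · by_cases hts : t ∈ Iic s
    · rw [indicator_of_mem hts, mul_one, abs_of_nonneg (le_max_left _ _)]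
      exact max_le hs ((min_le_left _ _).trans hts)
    · rw [indicator_of_notMem hts, mul_zero, abs_zero]
      exact hs

theorem singularValue_bddBelow (M : VonNeumannAlgebra H) (τ : (H →L[ℂ] H) → ℂ) (x : H →L[ℂ] H)
    (t : ℝ) :
    BddBelow {r : ℝ | ∃ e ∈ M, IsStarProjection e ∧ (τ (1 - e)).re ≤ t ∧ r = ‖x * e‖} :=
  ⟨0, by rintro _ ⟨e, -, -, -, rfl⟩; exact norm_nonneg _⟩

theorem norm_mem_singularValue_set (hτ : IsNormalizedTrace M τ) (x : H →L[ℂ] H) {t : ℝ}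
    (ht : 0 ≤ t) :
    ‖x‖ ∈ {r : ℝ | ∃ e ∈ M, IsStarProjection e ∧ (τ (1 - e)).re ≤ t ∧ r = ‖x * e‖} :=
  ⟨1, one_mem M, ⟨mul_one 1, star_one _⟩, by rwa [sub_self, hτ.map_zero], by rw [mul_one]⟩

theorem singularValue_nonneg (M : VonNeumannAlgebra H) (τ : (H →L[ℂ] H) → ℂ) (x : H →L[ℂ] H)
    (t : ℝ) : 0 ≤ singularValue M τ x t :=
  Real.sInf_nonneg (by rintro _ ⟨e, -, -, -, rfl⟩; exact norm_nonneg _)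

/-- The singular value function is the generalized inverse of the distribution function. -/
theorem singularValue_le_iff (hτ : IsNormalizedTrace M τ) {x : H →L[ℂ] H} (hx : x ∈ M)
    (hx0 : 0 ≤ x) {s t : ℝ} (hs : 0 ≤ s) (ht : 0 ≤ t) :
    singularValue M τ x t ≤ s ↔ distribution τ x s ≤ t := by
  constructor
  · refine fun h => distribution_le_of_forall_gt hτ hx fun r hr => ?_
    obtain ⟨_, ⟨e, heM, he, het, rfl⟩, her⟩ := exists_lt_of_csInf_lt
      ⟨_, norm_mem_singularValue_set hτ x ht⟩ (h.trans_lt hr)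
    exact (distribution_le_of_norm_mul_lt hτ hx hx0 he heM her).trans het
  · intro h
    refine (csInf_le (singularValue_bddBelow M τ x t) ⟨spectralProj x (Iic s),
      spectralProj_mem hx measurableSet_Iic, isStarProjection_spectralProj x measurableSet_Iic,
      ?_, rfl⟩).trans (norm_mul_spectralProj_Iic_le hx0 hs)
    rwa [← compl_Ioi, spectralProj_compl (isSelfAdjoint_of_nonneg hx0) measurableSet_Ioi,
      sub_sub_cancel]

theorem singularValue_le_norm (hτ : IsNormalizedTrace M τ) (x : H →L[ℂ] H) {t : ℝ}
    (ht : 0 ≤ t) : singularValue M τ x t ≤ ‖x‖ :=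
  csInf_le (singularValue_bddBelow M τ x t) (norm_mem_singularValue_set hτ x ht)

theorem singularValue_antitoneOn (hτ : IsNormalizedTrace M τ) (x : H →L[ℂ] H) :
    AntitoneOn (singularValue M τ x) (Ici 0) := fun _ hs t _ hst =>
  csInf_le_csInf (singularValue_bddBelow M τ x t) ⟨_, norm_mem_singularValue_set hτ x hs⟩
    fun _ ⟨e, heM, he, hes, hr⟩ => ⟨e, heM, he, hes.trans hst, hr⟩

theorem singularValue_eq_of_distribution_eq (hτ : IsNormalizedTrace M τ) {x y : H →L[ℂ] H}
    (hx : x ∈ M) (hx0 : 0 ≤ x) (hy : y ∈ M) (hy0 : 0 ≤ y)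
    (h : ∀ s, 0 ≤ s → distribution τ x s = distribution τ y s) {t : ℝ} (ht : 0 ≤ t) :
    singularValue M τ x t = singularValue M τ y t := by
  refine eq_of_forall_ge_iff fun s => ?_
  rcases lt_or_ge s 0 with hs | hs
  · have h1 := singularValue_nonneg M τ x t
    have h2 := singularValue_nonneg M τ y t
    constructor <;> intro h <;> linarith
  · rw [singularValue_le_iff hτ hx hx0 hs ht, singularValue_le_iff hτ hy hy0 hs ht, h s hs]

/-! ### The trace is determined by the distribution function -/

theorem sum_indicator_Ioi_bounds {ε : ℝ} (hε : 0 < ε) (N : ℕ) {t : ℝ} (ht : 0 ≤ t) :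
    min t (N * ε) ≤ ∑ k ∈ Finset.range N, ε * (Ioi (k * ε)).indicator (fun _ => (1 : ℝ)) t ∧
      ∑ k ∈ Finset.range N, ε * (Ioi (k * ε)).indicator (fun _ => (1 : ℝ)) t ≤
        min (N * ε) (t + ε) := by
  induction N with
  | zero => simp [ht, hε.le, add_nonneg]
  | succ N ih =>
    obtain ⟨ih1, ih2⟩ := ih
    rw [le_min_iff] at ih2
    rw [Finset.sum_range_succ]
    push_cast
    by_cases h : t ∈ Ioi (N * ε)
    · have h' : N * ε < t := h
      rw [indicator_of_mem h, mul_one]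
      rw [min_eq_right h'.le] at ih1
      exact ⟨(min_le_right _ _).trans (by linarith),
        le_min (by linarith [ih2.1]) (by linarith [ih2.1])⟩
    · have h' : t ≤ N * ε := not_lt.1 h
      rw [indicator_of_notMem h, mul_zero, add_zero]
      rw [min_eq_left h'] at ih1
      exact ⟨(min_le_left _ _).trans ih1, le_min (by linarith [ih2.1]) ih2.2⟩

theorem borelFC_sum_indicator (hτ : IsNormalizedTrace M τ) {x : H →L[ℂ] H} (hx : x ∈ M) (ε : ℝ)
    (N : ℕ) :
    (τ (borelFC x fun t =>
      ∑ k ∈ Finset.range N, ε * (Ioi (k * ε)).indicator (fun _ => (1 : ℝ)) t)).re =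
      ∑ k ∈ Finset.range N, ε * distribution τ x (k * ε) := by
  have hm : ∀ n : ℕ, Measurable fun t : ℝ =>
      ∑ k ∈ Finset.range n, ε * (Ioi (k * ε)).indicator (fun _ => (1 : ℝ)) t := fun n =>
    Finset.measurable_fun_sum _ fun k _ => (measurable_indicator_one measurableSet_Ioi).const_mul ε
  have hb : ∀ (n : ℕ) (t : ℝ),
      |∑ k ∈ Finset.range n, ε * (Ioi (k * ε)).indicator (fun _ => (1 : ℝ)) t| ≤ n * |ε| := by
    intro n t
    refine (Finset.abs_sum_le_sum_abs _ _).trans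
      ((Finset.sum_le_card_nsmul _ _ |ε| fun k _ => ?_).trans (by simp))
    rw [abs_mul]
    exact mul_le_of_le_one_right (abs_nonneg _) (abs_indicator_one_le _ _)
  induction N with
  | zero =>
    simp only [Finset.range_zero, Finset.sum_empty]
    rw [show borelFC x (fun _ => 0) = 0 from borelFC_eq fun v => by simp, hτ.map_zero,
      Complex.zero_re]
  | succ N ih =>
    have hi := measurable_indicator_one (measurableSet_Ioi (a := (N : ℝ) * ε))
    have hib : ∀ t, |ε * (Ioi ((N : ℝ) * ε)).indicator (fun _ => (1 : ℝ)) t| ≤ |ε| := fun t => by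
      rw [abs_mul]
      exact mul_le_of_le_one_right (abs_nonneg _) (abs_indicator_one_le _ _)
    simp only [Finset.sum_range_succ]
    rw [borelFC_add x (hm N) (hi.const_mul ε) (hb N) hib,
      borelFC_const_mul x hi (abs_indicator_one_le _),
      hτ.map_add _ (borelFC_mem hx (hm N) (hb N)) _
        (smul_mem (borelFC_mem hx hi (abs_indicator_one_le _)) _),
      hτ.map_smul _ _ (borelFC_mem hx hi (abs_indicator_one_le _)), Complex.add_re, ih,
      Complex.re_ofReal_mul]
    rfl

/-- The trace of `x ≥ 0` is approximated by Riemann sums of its distribution function. -/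
theorem abs_trace_sub_sum_le (hτ : IsNormalizedTrace M τ) {x : H →L[ℂ] H} (hx : x ∈ M)
    (hx0 : 0 ≤ x) {ε : ℝ} (hε : 0 < ε) {N : ℕ} (hN : ‖x‖ ≤ N * ε) :
    |(τ x).re - ∑ k ∈ Finset.range N, ε * distribution τ x (k * ε)| ≤ ε := by
  rw [← borelFC_sum_indicator hτ hx]
  set g : ℝ → ℝ := fun t => ∑ k ∈ Finset.range N, ε * (Ioi (k * ε)).indicator (fun _ => (1 : ℝ)) t
    with hg
  have hgm : Measurable g :=
    Finset.measurable_fun_sum _ fun k _ => (measurable_indicator_one measurableSet_Ioi).const_mul ε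
  have hgb : ∀ t, |g t| ≤ N * ε := by
    intro t
    refine (Finset.abs_sum_le_sum_abs _ _).trans
      ((Finset.sum_le_card_nsmul _ _ ε fun k _ => ?_).trans (by simp))
    rw [abs_mul, abs_of_pos hε]
    exact mul_le_of_le_one_right hε.le (abs_indicator_one_le _ _)
  have hcm := measurable_clamp ‖x‖
  have hcb := abs_clamp_le (norm_nonneg x)
  have hcx := borelFC_clamp hx0
  have hct : ∀ t ∈ spectrum ℝ x, max 0 (min t ‖x‖) = t := fun t ht => by
    have h := mem_Icc_of_mem_spectrum hx0 ht
    rw [min_eq_left h.2, max_eq_right h.1]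
  have h1 : x ≤ borelFC x g := by
    conv_lhs => rw [← hcx]
    refine borelFC_mono x hcm hgm hcb hgb fun t ht => ?_
    have h := mem_Icc_of_mem_spectrum hx0 ht
    have hb := (sum_indicator_Ioi_bounds hε N h.1).1
    rw [min_eq_left (h.2.trans hN)] at hb
    rw [hct t ht]
    exact hb
  have hone : ∀ t : ℝ, |(fun _ => (1 : ℝ)) t| ≤ 1 := by simp
  have hεb : ∀ t : ℝ, |ε * (fun _ => (1 : ℝ)) t| ≤ ε := by simp [abs_of_pos hε]
  have h2 : borelFC x g ≤ x + (ε : ℂ) • (1 : H →L[ℂ] H) := by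
    have hadd := borelFC_add x hcm (h := fun t => ε * (fun _ => (1 : ℝ)) t) (D := ε)
      measurable_const hcb hεb
    rw [borelFC_const_mul x measurable_const hone, hcx,
      borelFC_one (isSelfAdjoint_of_nonneg hx0)] at hadd
    rw [← hadd]
    refine borelFC_mono x hgm (hcm.add measurable_const) (D := ‖x‖ + ε) hgb
      (fun t => (abs_add_le _ _).trans (add_le_add (hcb t) (hεb t))) fun t ht => ?_
    have h := mem_Icc_of_mem_spectrum hx0 ht
    have hb := (sum_indicator_Ioi_bounds hε N h.1).2
    have := hct t ht
    simp only [this, mul_one]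
    exact hb.trans (min_le_right _ _)
  have hgM := borelFC_mem hx hgm hgb
  have h1' := hτ.mono hx hgM h1
  have h2' := hτ.mono hgM (add_mem hx (smul_mem (one_mem M) _)) h2
  rw [hτ.map_add _ hx _ (smul_mem (one_mem M) _), hτ.map_smul _ _ (one_mem M), hτ.map_one,
    Complex.add_re, mul_one, Complex.ofReal_re] at h2'
  rw [abs_le]
  constructor <;> linarith

theorem trace_eq_of_distribution_eq (hτ : IsNormalizedTrace M τ) {x y : H →L[ℂ] H}
    (hx : x ∈ M) (hx0 : 0 ≤ x) (hy : y ∈ M) (hy0 : 0 ≤ y)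
    (h : ∀ s, 0 ≤ s → distribution τ x s = distribution τ y s) : τ x = τ y := by
  refine Complex.ext ?_ ((hτ.nonneg x hx hx0).2.trans (hτ.nonneg y hy hy0).2.symm)
  refine eq_of_forall_dist_le fun ε hε => ?_
  obtain ⟨N, hN⟩ := exists_nat_ge (max ‖x‖ ‖y‖ / (ε / 2))
  rw [div_le_iff₀ (by positivity)] at hN
  have h1 := abs_trace_sub_sum_le hτ hx hx0 (half_pos hε) ((le_max_left _ _).trans hN)
  have h2 := abs_trace_sub_sum_le hτ hy hy0 (half_pos hε) ((le_max_right _ _).trans hN)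
  have hs : ∑ k ∈ Finset.range N, ε / 2 * distribution τ x (k * (ε / 2)) =
      ∑ k ∈ Finset.range N, ε / 2 * distribution τ y (k * (ε / 2)) :=
    Finset.sum_congr rfl fun k _ => by rw [h _ (by positivity)]
  rw [hs] at h1
  rw [Real.dist_eq]
  rw [abs_le] at h1 h2 ⊢
  constructor <;> linarith [h1.1, h1.2, h2.1, h2.2]

/-! ### Monotonicity of singular values on commuting operators -/

theorem norm_apply_le_of_commute {x y : H →L[ℂ] H} (hx : 0 ≤ x) (hxy : x ≤ y)
    (hc : Commute x y) (v : H) : ‖x v‖ ≤ ‖y v‖ := by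
  have hx' := isSelfAdjoint_of_nonneg hx
  have hy' := isSelfAdjoint_of_nonneg (hx.trans hxy)
  -- `y² - x² = (y - x) (y + x)` is a product of commuting positive operators
  have h : 0 ≤ (y - x) * (y + x) :=
    Commute.mul_nonneg (sub_nonneg.2 hxy) (add_nonneg (hx.trans hxy) hx)
      (((Commute.refl y).add_right hc.symm).sub_left (hc.add_right (Commute.refl x)))
  have h2 : x * x ≤ y * y := by
    rw [← sub_nonneg]
    convert h using 1
    rw [sub_mul, mul_add, mul_add, hc.eq]
    abel
  have hsq : ∀ {z : H →L[ℂ] H}, IsSelfAdjoint z → (inner ℂ v ((z * z) v)).re = ‖z v‖ ^ 2 := by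
    intro z hz
    rw [mul_apply_eq_comp,
      show inner ℂ v (z (z v)) = inner ℂ (z v) (z v) from (hz.isSymmetric v (z v)).symm,
      inner_self_eq_norm_sq_to_K]
    simp [← Complex.ofReal_pow]
  have h3 := inner_re_le_of_le h2 v
  rw [hsq hx', hsq hy'] at h3
  exact (abs_le_of_sq_le_sq' h3 (norm_nonneg _)).2

theorem singularValue_mono_of_commute (hτ : IsNormalizedTrace M τ) {x y : H →L[ℂ] H} (hx : 0 ≤ x)
    (hxy : x ≤ y) (hc : Commute x y) {t : ℝ} (ht : 0 ≤ t) :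
    singularValue M τ x t ≤ singularValue M τ y t := by
  refine le_csInf ⟨_, norm_mem_singularValue_set hτ y ht⟩ ?_
  rintro _ ⟨e, heM, he, het, rfl⟩
  refine (csInf_le (singularValue_bddBelow M τ x t) ⟨e, heM, he, het, rfl⟩).trans ?_
  refine ContinuousLinearMap.opNorm_le_bound _ (norm_nonneg _) fun v => ?_
  exact (norm_apply_le_of_commute hx hxy hc (e v)).trans ((y * e).le_opNorm v)

/-! ### Operators with continuous distribution -/

theorem distribution_zero_of_hasContinuousDistribution (hτ : IsNormalizedTrace M τ)
    {a : H →L[ℂ] H} (hac : HasContinuousDistribution a) : distribution τ a 0 = 1 := by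
  have h : ¬ _ := Set.eq_empty_iff_forall_notMem.1 hac 0
  have hE : spectralProj a (Ioi 0) = 1 := by
    by_contra hne
    exact h (Or.inr ⟨rfl, hne⟩)
  rw [distribution, hE, hτ.map_one, Complex.one_re]

/-- Left continuity of the distribution function: the strong continuity of the resolution is
transferred to the trace by normality. -/
theorem exists_distribution_lt_of_lt (hτ : IsNormalizedTrace M τ) {a : H →L[ℂ] H} (haM : a ∈ M)
    (ha : 0 ≤ a) (hac : HasContinuousDistribution a) {l u : ℝ} (hl : l ∈ Ioc 0 ‖a‖)
    (hu : distribution τ a l < u) : ∃ s < l, distribution τ a s < u := by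
  have hsa := isSelfAdjoint_of_nonneg ha
  have hcont : ∀ v : H, ContinuousWithinAt (fun s => spectralProj a (Ioi s) v) (Icc 0 ‖a‖) l := by
    by_contra hne
    exact Set.eq_empty_iff_forall_notMem.1 hac l (Or.inl ⟨hl, hne⟩)
  set r : ℕ → ℝ := fun n => l - l / ((n : ℝ) + 1) with hr
  have hrl : ∀ n, r n < l := fun n => sub_lt_self _ (div_pos hl.1 (by positivity))
  have hr0 : ∀ n, 0 ≤ r n := fun n =>
    sub_nonneg.2 (div_le_self hl.1.le (by linarith [n.cast_nonneg (α := ℝ)]))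
  have hrm : Monotone r := fun m n hmn => by
    have := hl.1.le
    simp only [hr]
    gcongr
  have hrlim : Tendsto r atTop (𝓝[Icc 0 ‖a‖] l) := by
    refine tendsto_nhdsWithin_iff.2 ⟨?_, Eventually.of_forall fun n =>
      ⟨hr0 n, (hrl n).le.trans hl.2⟩⟩
    have h := (tendsto_one_div_add_atTop_nhds_zero_nat (𝕜 := ℝ)).const_mul l
    have h' := h.const_sub l
    simpa [hr, div_eq_mul_inv] using h'
  have hcompl : ∀ s, spectralProj a (Iic s) = 1 - spectralProj a (Ioi s) := fun s => by
    rw [← compl_Ioi, spectralProj_compl hsa measurableSet_Ioi]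
  have hlim := hτ.tendsto_of_monotone (E := fun n => spectralProj a (Iic (r n)))
    (F := spectralProj a (Iic l))
    (fun m n hmn => spectralProj_mono a measurableSet_Iic measurableSet_Iic
      (Iic_subset_Iic.2 (hrm hmn)))
    (fun n => spectralProj_mem haM measurableSet_Iic)
    (fun n => (isStarProjection_spectralProj a measurableSet_Iic).nonneg)
    (spectralProj_mem haM measurableSet_Iic)
    (isStarProjection_spectralProj a measurableSet_Iic).isSelfAdjoint fun v => by
      simp only [hcompl, sub_apply, one_apply_eq_self]
      have h1 : Tendsto (fun n => v - spectralProj a (Ioi (r n)) v) atTop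
          (𝓝 (v - spectralProj a (Ioi l) v)) := ((hcont v).tendsto.comp hrlim).const_sub v
      exact (Complex.continuous_re.tendsto _).comp (Tendsto.inner tendsto_const_nhds h1)
  simp only [hcompl, hτ.map_one_sub (spectralProj_mem haM measurableSet_Ioi)] at hlim
  change Tendsto (fun n => 1 - distribution τ a (r n)) atTop (𝓝 (1 - distribution τ a l)) at hlim
  have hlim' := hlim.const_sub 1
  simp only [sub_sub_cancel] at hlim'
  obtain ⟨n, hn⟩ := (hlim'.eventually_lt_const hu).exists
  exact ⟨r n, hrl n, hn⟩

theorem exists_lt_distribution_of_gt (hτ : IsNormalizedTrace M τ) {a : H →L[ℂ] H} (haM : a ∈ M)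
    {l u : ℝ} (hu : u < distribution τ a l) : ∃ s > l, u < distribution τ a s := by
  by_contra! h
  exact absurd (distribution_le_of_forall_gt hτ haM h) (not_le.2 hu)

theorem continuousOn_distribution (hτ : IsNormalizedTrace M τ) {a : H →L[ℂ] H} (haM : a ∈ M)
    (ha : 0 ≤ a) (hac : HasContinuousDistribution a) :
    ContinuousOn (distribution τ a) (Icc 0 ‖a‖) := by
  have hanti := distribution_antitone hτ haM
  refine fun l hl => tendsto_order.2 ⟨fun u hu => ?_, fun u hu => ?_⟩
  · obtain ⟨s, hs, hsu⟩ := exists_lt_distribution_of_gt hτ haM hu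
    filter_upwards [mem_nhdsWithin_of_mem_nhds (Iio_mem_nhds hs)] with r hr
    exact hsu.trans_le (hanti (le_of_lt hr))
  · rcases hl.1.eq_or_lt with h0 | h0
    · filter_upwards [self_mem_nhdsWithin] with r hr
      exact (hanti (h0 ▸ hr.1)).trans_lt hu
    · obtain ⟨s, hs, hsu⟩ := exists_distribution_lt_of_lt hτ haM ha hac ⟨h0, hl.2⟩ hu
      filter_upwards [mem_nhdsWithin_of_mem_nhds (Ioi_mem_nhds hs)] with r hr
      exact (hanti (le_of_lt hr)).trans_lt hsu

theorem exists_distribution_eq (hτ : IsNormalizedTrace M τ) {a : H →L[ℂ] H} (haM : a ∈ M)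
    (ha : 0 ≤ a) (hac : HasContinuousDistribution a) {d : ℝ} (hd0 : 0 ≤ d) (hd1 : d ≤ 1) :
    ∃ t ∈ Icc 0 ‖a‖, distribution τ a t = d := by
  refine intermediate_value_Icc' (norm_nonneg a) (continuousOn_distribution hτ haM ha hac) ⟨?_, ?_⟩
  · rwa [distribution_of_norm_le hτ le_rfl]
  · rwa [distribution_zero_of_hasContinuousDistribution hτ hac]

theorem measurableSet_distribution_lt (hτ : IsNormalizedTrace M τ) {a : H →L[ℂ] H} (haM : a ∈ M)
    (d : ℝ) : MeasurableSet {t | distribution τ a t < d} :=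
  (distribution_antitone hτ haM).measurable measurableSet_Iio

/-- Plateaus of the distribution function are null for the spectral measure: with `t₁` the right end
of the plateau through `t₀`, the projections of `(t₁, ∞)` and `(t₀, ∞)` have equal trace. -/
theorem spectralProj_distribution_lt (hτ : IsNormalizedTrace M τ) {a : H →L[ℂ] H} (haM : a ∈ M)
    (ha : 0 ≤ a) (hac : HasContinuousDistribution a) {t₀ : ℝ} (ht₀ : t₀ ∈ Icc 0 ‖a‖) :
    spectralProj a {t | distribution τ a t < distribution τ a t₀} = spectralProj a (Ioi t₀) := by
  have hanti := distribution_antitone hτ haM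
  have hcomp : IsCompact (Icc 0 ‖a‖ ∩ distribution τ a ⁻¹' {distribution τ a t₀}) :=
    isCompact_Icc.of_isClosed_subset
      ((continuousOn_distribution hτ haM ha hac).preimage_isClosed_of_isClosed
        isClosed_Icc isClosed_singleton) inter_subset_left
  obtain ⟨t₁, ⟨ht₁, ht₁e⟩, hmax⟩ := hcomp.exists_isGreatest ⟨t₀, ht₀, rfl⟩
  have ht₁e' : distribution τ a t₁ = distribution τ a t₀ := ht₁e
  refine hτ.eq_of_le (spectralProj_mem haM (measurableSet_distribution_lt hτ haM _))
    (spectralProj_mem haM measurableSet_Ioi)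
    (spectralProj_mono a (measurableSet_distribution_lt hτ haM _) measurableSet_Ioi
      fun t ht => ?_) ?_
  · exact not_le.1 fun h => not_le.2 ht (hanti h)
  · change distribution τ a t₀ ≤ _
    rw [← ht₁e']
    refine hτ.mono (spectralProj_mem haM measurableSet_Ioi)
      (spectralProj_mem haM (measurableSet_distribution_lt hτ haM _))
      (spectralProj_le_of_forall_mem_spectrum a measurableSet_Ioi
        (measurableSet_distribution_lt hτ haM _) fun t ht ht1 => ?_)
    have htI := mem_Icc_of_mem_spectrum ha ht
    refine lt_of_le_of_ne (hanti (le_of_lt ht1)) fun he => ?_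
    exact not_lt.2 (hmax ⟨htI, he.trans ht₁e'⟩) ht1

/-! ### The canonical model function -/

/-- The rearrangement of `b` along the spectral resolution of `a`: the function
`t ↦ μ_b(τ(Pᵃ(t, ∞)))`, defined on the whole line. -/
noncomputable def rearrangement (M : VonNeumannAlgebra H) (τ : (H →L[ℂ] H) → ℂ)
    (a b : H →L[ℂ] H) (t : ℝ) : ℝ :=
  singularValue M τ b (distribution τ a t)

section Rearrangement

variable {a b : H →L[ℂ] H}

theorem rearrangement_nonneg (M : VonNeumannAlgebra H) (τ : (H →L[ℂ] H) → ℂ) (a b : H →L[ℂ] H)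
    (t : ℝ) : 0 ≤ rearrangement M τ a b t :=
  singularValue_nonneg M τ b _

theorem rearrangement_le_norm (hτ : IsNormalizedTrace M τ) (haM : a ∈ M) (b : H →L[ℂ] H)
    (t : ℝ) : rearrangement M τ a b t ≤ ‖b‖ :=
  singularValue_le_norm hτ b (distribution_nonneg hτ haM t)

theorem abs_rearrangement_le (hτ : IsNormalizedTrace M τ) (haM : a ∈ M) (b : H →L[ℂ] H)
    (t : ℝ) : |rearrangement M τ a b t| ≤ ‖b‖ := by
  rw [abs_of_nonneg (rearrangement_nonneg M τ a b t)]
  exact rearrangement_le_norm hτ haM b t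

theorem rearrangement_monotone (hτ : IsNormalizedTrace M τ) (haM : a ∈ M) (b : H →L[ℂ] H) :
    Monotone (rearrangement M τ a b) := fun s t hst =>
  singularValue_antitoneOn hτ b (distribution_nonneg hτ haM t) (distribution_nonneg hτ haM s)
    (distribution_antitone hτ haM hst)

theorem rearrangement_measurable (hτ : IsNormalizedTrace M τ) (haM : a ∈ M) (b : H →L[ℂ] H) :
    Measurable (rearrangement M τ a b) :=
  (rearrangement_monotone hτ haM b).measurable

theorem lt_rearrangement_iff (hτ : IsNormalizedTrace M τ) (haM : a ∈ M) (hbM : b ∈ M) (hb : 0 ≤ b)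
    {s : ℝ} (hs : 0 ≤ s) (t : ℝ) :
    s < rearrangement M τ a b t ↔ distribution τ a t < distribution τ b s := by
  rw [← not_le, ← not_le, rearrangement,
    singularValue_le_iff hτ hbM hb hs (distribution_nonneg hτ haM t)]

theorem isModelFunctionOn_rearrangement (hτ : IsNormalizedTrace M τ) (haM : a ∈ M) (ha : 0 ≤ a)
    (hac : HasContinuousDistribution a) (hbM : b ∈ M) (hb : 0 ≤ b) :
    IsModelFunctionOn ‖a‖ (rearrangement M τ a b) := by
  refine ⟨fun t _ => rearrangement_nonneg M τ a b t,
    (rearrangement_monotone hτ haM b).monotoneOn _, fun t ht => tendsto_order.2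
      ⟨fun u hu => ?_, fun u hu => ?_⟩⟩
  · rcases lt_or_ge u 0 with h0 | h0
    · exact Eventually.of_forall fun s => h0.trans_le (rearrangement_nonneg M τ a b s)
    · rw [lt_rearrangement_iff hτ haM hbM hb h0] at hu
      have hc := (continuousOn_distribution hτ haM ha hac t ht).mono (Icc_subset_Icc_right ht.2)
      filter_upwards [hc.tendsto.eventually_lt_const hu] with s hs
      rwa [lt_rearrangement_iff hτ haM hbM hb h0]
  · filter_upwards [self_mem_nhdsWithin] with s hs
    exact (rearrangement_monotone hτ haM b hs.2).trans_lt hu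

theorem spectralProj_borelFC_rearrangement (hτ : IsNormalizedTrace M τ) (haM : a ∈ M)
    (ha : 0 ≤ a) (hac : HasContinuousDistribution a) (hbM : b ∈ M) (hb : 0 ≤ b) {s t : ℝ}
    (hs : 0 ≤ s) (ht : t ∈ Icc 0 ‖a‖) (hst : distribution τ a t = distribution τ b s) :
    spectralProj (borelFC a (rearrangement M τ a b)) (Ioi s) = spectralProj a (Ioi t) := by
  rw [spectralProj_borelFC (isSelfAdjoint_of_nonneg ha) (rearrangement_measurable hτ haM b)
    (abs_rearrangement_le hτ haM b) measurableSet_Ioi,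
    ← spectralProj_distribution_lt hτ haM ha hac ht, hst]
  congr 1
  ext r
  exact lt_rearrangement_iff hτ haM hbM hb hs r

theorem borelFC_rearrangement_mem (hτ : IsNormalizedTrace M τ) (haM : a ∈ M) (b : H →L[ℂ] H) :
    borelFC a (rearrangement M τ a b) ∈ M :=
  borelFC_mem haM (rearrangement_measurable hτ haM b) (abs_rearrangement_le hτ haM b)

theorem borelFC_rearrangement_nonneg (hτ : IsNormalizedTrace M τ) (haM : a ∈ M)
    (b : H →L[ℂ] H) : 0 ≤ borelFC a (rearrangement M τ a b) :=
  borelFC_nonneg a (rearrangement_measurable hτ haM b) (abs_rearrangement_le hτ haM b)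
    fun t _ => rearrangement_nonneg M τ a b t

/-- The operator `k_b(a)`, with `k_b` the rearrangement of `b`, is equidistributed with `b`. -/
theorem distribution_borelFC_rearrangement (hτ : IsNormalizedTrace M τ) (haM : a ∈ M)
    (ha : 0 ≤ a) (hac : HasContinuousDistribution a) (hbM : b ∈ M) (hb : 0 ≤ b) {s : ℝ}
    (hs : 0 ≤ s) :
    distribution τ (borelFC a (rearrangement M τ a b)) s = distribution τ b s := by
  obtain ⟨t, ht, hst⟩ := exists_distribution_eq hτ haM ha hac (distribution_nonneg hτ hbM s)
    (distribution_le_one hτ hbM s)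
  rw [← hst, distribution, spectralProj_borelFC_rearrangement hτ haM ha hac hbM hb hs ht hst,
    distribution]

theorem singularValue_borelFC_rearrangement (hτ : IsNormalizedTrace M τ) (haM : a ∈ M)
    (ha : 0 ≤ a) (hac : HasContinuousDistribution a) (hbM : b ∈ M) (hb : 0 ≤ b) {t : ℝ}
    (ht : 0 ≤ t) :
    singularValue M τ b t = singularValue M τ (borelFC a (rearrangement M τ a b)) t :=
  singularValue_eq_of_distribution_eq hτ hbM hb (borelFC_rearrangement_mem hτ haM b)
    (borelFC_rearrangement_nonneg hτ haM b)
    (fun _ hs => (distribution_borelFC_rearrangement hτ haM ha hac hbM hb hs).symm) ht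

theorem trace_borelFC_rearrangement (hτ : IsNormalizedTrace M τ) (haM : a ∈ M)
    (ha : 0 ≤ a) (hac : HasContinuousDistribution a) (hbM : b ∈ M) (hb : 0 ≤ b) :
    τ (borelFC a (rearrangement M τ a b)) = τ b :=
  trace_eq_of_distribution_eq hτ (borelFC_rearrangement_mem hτ haM b)
    (borelFC_rearrangement_nonneg hτ haM b) hbM hb
    fun _ hs => distribution_borelFC_rearrangement hτ haM ha hac hbM hb hs

theorem spectrallyDominated_iff_borelFC_rearrangement_le (hτ : IsNormalizedTrace M τ)
    (haM : a ∈ M) (ha : 0 ≤ a) (hac : HasContinuousDistribution a) (hbM : b ∈ M) (hb : 0 ≤ b)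
    {c : H →L[ℂ] H} (hcM : c ∈ M) (hc : 0 ≤ c) :
    SpectrallyDominated M τ c b ↔
      borelFC a (rearrangement M τ a c) ≤ borelFC a (rearrangement M τ a b) := by
  have hmb := rearrangement_measurable hτ haM b
  have hmc := rearrangement_measurable hτ haM c
  have hbb := abs_rearrangement_le hτ haM b
  have hbc := abs_rearrangement_le hτ haM c
  refine ⟨fun h => borelFC_mono a hmc hmb hbc hbb fun t _ => h _ (distribution_nonneg hτ haM t),
    fun h t ht => ?_⟩
  rw [singularValue_borelFC_rearrangement hτ haM ha hac hbM hb ht,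
    singularValue_borelFC_rearrangement hτ haM ha hac hcM hc ht]
  refine singularValue_mono_of_commute hτ (borelFC_rearrangement_nonneg hτ haM c) h ?_ ht
  rw [Commute, SemiconjBy, ← borelFC_mul a hmc hmb hbc hbb, ← borelFC_mul a hmb hmc hbb hbc]
  simp only [mul_comm]

end Rearrangement

/-! ### Refinement of resolutions -/

section Refinement

variable {a b : H →L[ℂ] H}

theorem distribution_eq_of_isRefinementMap {f : ℝ → ℝ}
    (hf : IsRefinementMap (inducedResolution a) (inducedResolution b) f) {l : ℝ}
    (hl : l ∈ Icc 0 ‖b‖) : distribution τ a (f l) = distribution τ b l :=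
  congrArg (fun p => (τ p).re) (hf.eq l hl).symm

theorem borelFC_rearrangement_eq_of_refines (hτ : IsNormalizedTrace M τ) (haM : a ∈ M)
    (ha : 0 ≤ a) (hac : HasContinuousDistribution a) (hbM : b ∈ M) (hb : 0 ≤ b)
    (h : Refines (inducedResolution a) (inducedResolution b)) :
    borelFC a (rearrangement M τ a b) = b := by
  obtain ⟨f, hf⟩ := h
  refine eq_of_forall_spectralProj_Ioi_eq (borelFC_rearrangement_nonneg hτ haM b) hb fun s hs => ?_
  rcases le_or_gt s ‖b‖ with hsb | hsb
  · have hsI : s ∈ Icc 0 ‖b‖ := ⟨hs, hsb⟩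
    rw [spectralProj_borelFC_rearrangement hτ haM ha hac hbM hb hs (hf.mapsTo hsI)
      (distribution_eq_of_isRefinementMap hf hsI)]
    exact (hf.eq s hsI).symm
  · rw [spectralProj_Ioi_of_norm_le hsb.le, spectralProj_Ioi_of_norm_le]
    exact (norm_borelFC_le (isSelfAdjoint_of_nonneg ha) (rearrangement_measurable hτ haM b)
      (abs_rearrangement_le hτ haM b) (norm_nonneg b)
      fun t _ => abs_rearrangement_le hτ haM b t).trans hsb.le

theorem refines_of_borelFC_rearrangement_eq (hτ : IsNormalizedTrace M τ) (haM : a ∈ M)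
    (ha : 0 ≤ a) (hac : HasContinuousDistribution a) (hbM : b ∈ M) (hb : 0 ≤ b)
    (h : borelFC a (rearrangement M τ a b) = b) :
    Refines (inducedResolution a) (inducedResolution b) := by
  have hanti := distribution_antitone hτ haM
  have hantib := distribution_antitone hτ hbM
  -- `f l` is the largest `t` with `d_b(l) ≤ d_a(t)`
  have hex : ∀ l, ∃ m, IsGreatest
      (Icc 0 ‖a‖ ∩ distribution τ a ⁻¹' Ici (distribution τ b l)) m := fun l => by
    have hcomp : IsCompact (Icc 0 ‖a‖ ∩ distribution τ a ⁻¹' Ici (distribution τ b l)) :=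
      isCompact_Icc.of_isClosed_subset
        ((continuousOn_distribution hτ haM ha hac).preimage_isClosed_of_isClosed
          isClosed_Icc isClosed_Ici) inter_subset_left
    refine hcomp.exists_isGreatest ⟨0, ⟨le_rfl, norm_nonneg a⟩, ?_⟩
    rw [mem_preimage, distribution_zero_of_hasContinuousDistribution hτ hac]
    exact distribution_le_one hτ hbM l
  choose f hf using hex
  have hlt : ∀ l, ∀ t ∈ Icc 0 ‖a‖, f l < t ↔ distribution τ a t < distribution τ b l := by
    intro l t ht
    constructor
    · exact fun h => not_le.1 fun h' => not_le.2 h ((hf l).2 ⟨ht, h'⟩)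
    · exact fun h => not_le.1 fun h' => not_le.2 h ((hf l).1.2.trans (hanti h'))
  have hmono : Monotone f := fun l m hlm =>
    (hf m).2 ⟨(hf l).1.1, (hantib hlm).trans (hf l).1.2⟩
  refine ⟨f, ⟨fun l _ => (hf l).1.1, hmono.monotoneOn _, fun l _ => tendsto_order.2
    ⟨fun u hu => ?_, fun u hu => ?_⟩, ?_, fun l hl => ?_⟩⟩
  · filter_upwards [self_mem_nhdsWithin] with s hs
    exact hu.trans_le (hmono hs.1)
  · rcases lt_or_ge ‖a‖ u with hua | hua
    · exact Eventually.of_forall fun s => (hf s).1.1.2.trans_lt hua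
    · have huI : u ∈ Icc 0 ‖a‖ := ⟨(hf l).1.1.1.trans hu.le, hua⟩
      obtain ⟨r, hr, hur⟩ := exists_lt_distribution_of_gt hτ hbM ((hlt l u huI).1 hu)
      filter_upwards [mem_nhdsWithin_of_mem_nhds (Iio_mem_nhds hr)] with s hs
      exact (hmono (le_of_lt hs)).trans_lt ((hlt r u huI).2 hur)
  · refine le_antisymm (hf _).1.1.2 ((hf _).2 ⟨⟨norm_nonneg a, le_rfl⟩, ?_⟩)
    change distribution τ b ‖b‖ ≤ distribution τ a ‖a‖
    rw [distribution_of_norm_le hτ le_rfl, distribution_of_norm_le hτ le_rfl]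
  · change spectralProj b (Ioi l) = spectralProj a (Ioi (f l))
    conv_lhs => rw [← h]
    rw [spectralProj_borelFC (isSelfAdjoint_of_nonneg ha) (rearrangement_measurable hτ haM b)
      (abs_rearrangement_le hτ haM b) measurableSet_Ioi]
    refine spectralProj_congr fun t ht => ?_
    rw [mem_Ioi, hlt l t (mem_Icc_of_mem_spectrum ha ht)]
    exact lt_rearrangement_iff hτ haM hbM hb hl.1 t

/-! ### Strong refinement -/

/-- The lower adjoint of a refinement map `f` from the resolution of `b` to that of `a`: the least
`l ∈ [0, ‖b‖]` with `t ≤ f l`. Truncating `t` at `‖a‖` keeps the function monotone on the line. -/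
noncomputable def refinementInverse (a b : H →L[ℂ] H) (f : ℝ → ℝ) (t : ℝ) : ℝ :=
  sInf (Icc 0 ‖b‖ ∩ {l | min t ‖a‖ ≤ f l})

variable {f : ℝ → ℝ}

theorem norm_mem_refinementInverse_set
    (hf : IsRefinementMap (inducedResolution a) (inducedResolution b) f) (t : ℝ) :
    ‖b‖ ∈ Icc 0 ‖b‖ ∩ {l | min t ‖a‖ ≤ f l} :=
  ⟨⟨norm_nonneg b, le_rfl⟩, (min_le_right _ _).trans hf.map_hi.ge⟩

theorem refinementInverse_bddBelow (a b : H →L[ℂ] H) (f : ℝ → ℝ) (t : ℝ) :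
    BddBelow (Icc 0 ‖b‖ ∩ {l | min t ‖a‖ ≤ f l}) :=
  ⟨0, fun _ h => h.1.1⟩

theorem refinementInverse_mem
    (hf : IsRefinementMap (inducedResolution a) (inducedResolution b) f) (t : ℝ) :
    refinementInverse a b f t ∈ Icc 0 ‖b‖ :=
  ⟨le_csInf ⟨_, norm_mem_refinementInverse_set hf t⟩ fun _ h => h.1.1,
    csInf_le (refinementInverse_bddBelow a b f t) (norm_mem_refinementInverse_set hf t)⟩

theorem refinementInverse_le_iff
    (hf : IsRefinementMap (inducedResolution a) (inducedResolution b) f) {t l : ℝ}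
    (hl : l ∈ Icc 0 ‖b‖) : refinementInverse a b f t ≤ l ↔ min t ‖a‖ ≤ f l := by
  have hmem := refinementInverse_mem hf t
  constructor
  · intro h
    refine le_trans ?_ (hf.monotone hmem hl h)
    -- right-continuity of `f` makes the infimum a minimum
    by_contra! hlt
    have hev := (hf.right_continuous _ hmem).tendsto.eventually_lt_const hlt
    obtain ⟨ε, hε, hball⟩ := Metric.mem_nhdsWithin_iff.1 hev
    obtain ⟨r, hr, hrε⟩ := exists_lt_of_csInf_lt ⟨_, norm_mem_refinementInverse_set hf t⟩
      (lt_add_of_pos_right (refinementInverse a b f t) hε)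
    have hle : refinementInverse a b f t ≤ r := csInf_le (refinementInverse_bddBelow a b f t) hr
    have hrb : r ∈ Metric.ball (refinementInverse a b f t) ε := by
      rw [Metric.mem_ball, Real.dist_eq, abs_of_nonneg (sub_nonneg.2 hle)]
      linarith
    have hfr : f r < min t ‖a‖ := hball ⟨hrb, hle, hr.1.2⟩
    exact not_lt.2 hr.2 hfr
  · exact fun h => csInf_le (refinementInverse_bddBelow a b f t) ⟨hl, h⟩

theorem refinementInverse_monotone
    (hf : IsRefinementMap (inducedResolution a) (inducedResolution b) f) :
    Monotone (refinementInverse a b f) := fun _ t hst =>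
  csInf_le_csInf (refinementInverse_bddBelow a b f _) ⟨_, norm_mem_refinementInverse_set hf t⟩
    fun _ h => ⟨h.1, (min_le_min_right _ hst).trans h.2⟩

theorem abs_refinementInverse_le
    (hf : IsRefinementMap (inducedResolution a) (inducedResolution b) f) (t : ℝ) :
    |refinementInverse a b f t| ≤ ‖b‖ := by
  rw [abs_of_nonneg (refinementInverse_mem hf t).1]
  exact (refinementInverse_mem hf t).2

/-- For `0 ≤ s ≤ ‖b‖` the set where the inverse of `f` exceeds `s` is the half-line `(f s, ∞)` up to
points outside the spectrum of `a`, so both operators have the same resolution. -/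
theorem borelFC_refinementInverse (ha : 0 ≤ a) (hb : 0 ≤ b)
    (hf : IsRefinementMap (inducedResolution a) (inducedResolution b) f) :
    borelFC a (refinementInverse a b f) = b := by
  have hm := (refinementInverse_monotone hf).measurable
  have hbd := abs_refinementInverse_le hf
  refine eq_of_forall_spectralProj_Ioi_eq (borelFC_nonneg a hm hbd
    fun t _ => (refinementInverse_mem hf t).1) hb fun s hs => ?_
  rcases le_or_gt s ‖b‖ with hsb | hsb
  · have hsI : s ∈ Icc 0 ‖b‖ := ⟨hs, hsb⟩
    rw [spectralProj_borelFC (isSelfAdjoint_of_nonneg ha) hm hbd measurableSet_Ioi]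
    refine Eq.trans (spectralProj_congr fun t ht => ?_) (hf.eq s hsI).symm
    rw [mem_preimage, mem_Ioi, mem_Ioi, ← not_le, refinementInverse_le_iff hf hsI, not_le,
      min_eq_left (mem_Icc_of_mem_spectrum ha ht).2]
  · rw [spectralProj_Ioi_of_norm_le hsb.le, spectralProj_Ioi_of_norm_le]
    exact (norm_borelFC_le (isSelfAdjoint_of_nonneg ha) hm hbd (norm_nonneg b)
      fun t _ => hbd t).trans hsb.le

theorem continuousOn_refinementInverse
    (hf : IsRefinementMap (inducedResolution a) (inducedResolution b) f)
    (hexp : ∀ l ∈ Icc 0 ‖b‖, ∀ m ∈ Icc 0 ‖b‖, m < l → l - m ≤ f l - f m) :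
    ContinuousOn (refinementInverse a b f) (Icc 0 ‖a‖) := by
  refine (LipschitzOnWith.of_le_add fun t ht s hs => ?_ :
    LipschitzOnWith 1 (refinementInverse a b f) (Icc 0 ‖a‖)).continuousOn
  rcases le_or_gt t s with hts | hts
  · exact (refinementInverse_monotone hf hts).trans (le_add_of_nonneg_right dist_nonneg)
  · rw [Real.dist_eq, abs_of_pos (sub_pos.2 hts)]
    have hmem := refinementInverse_mem hf s
    rcases le_or_gt (refinementInverse a b f s + (t - s)) ‖b‖ with hle | hgt
    · have hlI : refinementInverse a b f s + (t - s) ∈ Icc 0 ‖b‖ :=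
        ⟨by linarith [hmem.1], hle⟩
      rw [refinementInverse_le_iff hf hlI, min_eq_left ht.2]
      have h1 := hexp _ hlI _ hmem (by linarith)
      have h2 := (refinementInverse_le_iff hf hmem).1 (le_refl (refinementInverse a b f s))
      rw [min_eq_left hs.2] at h2
      linarith
    · exact (refinementInverse_mem hf t).2.trans hgt.le

end Refinement

/-! ### The choice of the model functions -/

open Classical in
/-- The model function `h_b`. Both branches give the same operator `h_b(a)`; when the resolution of
`a` strongly refines that of `b`, the rearrangement of `b` may still jump across a gap of the
spectrum of `a`, and the inverse of a refinement map is a continuous replacement for it. -/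
noncomputable def modelFunction (M : VonNeumannAlgebra H) (τ : (H →L[ℂ] H) → ℂ)
    (a b : H →L[ℂ] H) : ℝ → ℝ :=
  if h : StronglyRefines (inducedResolution a) (inducedResolution b) then
    refinementInverse a b h.choose
  else rearrangement M τ a b

section ModelFunction

variable {a b : H →L[ℂ] H}

theorem continuousOn_modelFunction (M : VonNeumannAlgebra H) (τ : (H →L[ℂ] H) → ℂ)
    (h : StronglyRefines (inducedResolution a) (inducedResolution b)) :
    ContinuousOn (modelFunction M τ a b) (Icc 0 ‖a‖) := by
  rw [modelFunction, dif_pos h]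
  exact continuousOn_refinementInverse h.choose_spec.1 h.choose_spec.2.2

theorem isModelFunctionOn_modelFunction (hτ : IsNormalizedTrace M τ) (haM : a ∈ M) (ha : 0 ≤ a)
    (hac : HasContinuousDistribution a) (hbM : b ∈ M) (hb : 0 ≤ b) :
    IsModelFunctionOn ‖a‖ (modelFunction M τ a b) := by
  by_cases h : StronglyRefines (inducedResolution a) (inducedResolution b)
  · have hc := continuousOn_modelFunction M τ h
    rw [modelFunction, dif_pos h] at hc ⊢
    have hf := h.choose_spec.1
    exact ⟨fun t _ => (refinementInverse_mem hf t).1, (refinementInverse_monotone hf).monotoneOn _,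
      fun t ht => (hc t ht).mono (Icc_subset_Icc_right ht.2)⟩
  · rw [modelFunction, dif_neg h]
    exact isModelFunctionOn_rearrangement hτ haM ha hac hbM hb

theorem borelFC_modelFunction (hτ : IsNormalizedTrace M τ) (haM : a ∈ M) (ha : 0 ≤ a)
    (hac : HasContinuousDistribution a) (hbM : b ∈ M) (hb : 0 ≤ b) :
    borelFC a (modelFunction M τ a b) = borelFC a (rearrangement M τ a b) := by
  by_cases h : StronglyRefines (inducedResolution a) (inducedResolution b)
  · rw [modelFunction, dif_pos h, borelFC_refinementInverse ha hb h.choose_spec.1,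
      borelFC_rearrangement_eq_of_refines hτ haM ha hac hbM hb ⟨_, h.choose_spec.1⟩]
  · rw [modelFunction, dif_neg h]

end ModelFunction

theorem submajorized_congr {x x' y y' : H →L[ℂ] H}
    (hx : ∀ t, 0 ≤ t → singularValue M τ x t = singularValue M τ x' t)
    (hy : ∀ t, 0 ≤ t → singularValue M τ y t = singularValue M τ y' t) :
    Submajorized M τ x y ↔ Submajorized M τ x' y' := by
  refine forall₂_congr fun s hs => ?_
  rw [intervalIntegral.integral_congr fun t ht => hx t (uIcc_of_le hs ▸ ht).1,
    intervalIntegral.integral_congr fun t ht => hy t (uIcc_of_le hs ▸ ht).1]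

end IIOneModel

open IIOneModel in
theorem theorem4p4 {H : Type*} [NormedAddCommGroup H] [InnerProductSpace ℂ H] [CompleteSpace H]
    (M : VonNeumannAlgebra H) (hM : IsIIOneFactor M)
    (τ : (H →L[ℂ] H) → ℂ) (hτ : IsNormalizedTrace M τ)
    (a : H →L[ℂ] H) (haM : a ∈ M) (ha : 0 ≤ a) (hac : HasContinuousDistribution a) :
    ∃ h : (H →L[ℂ] H) → ℝ → ℝ,
      (∀ b ∈ M, 0 ≤ b →
        IsModelFunctionOn ‖a‖ (h b) ∧ borelFC a (h b) ∈ M ∧ 0 ≤ borelFC a (h b) ∧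
        ∀ t : ℝ, 0 ≤ t → singularValue M τ b t = singularValue M τ (borelFC a (h b)) t) ∧
      (∀ b ∈ M, 0 ≤ b →
        (Refines (inducedResolution a) (inducedResolution b) ↔ borelFC a (h b) = b) ∧
        (StronglyRefines (inducedResolution a) (inducedResolution b) →
          ContinuousOn (h b) (Set.Icc 0 ‖a‖))) ∧
      (∀ b ∈ M, 0 ≤ b → ∀ c ∈ M, 0 ≤ c →
        (SpectrallyDominated M τ c b ↔ borelFC a (h c) ≤ borelFC a (h b)) ∧
        (Submajorized M τ c b ↔ Submajorized M τ (borelFC a (h c)) (borelFC a (h b))) ∧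
        (Majorized M τ c b ↔ Majorized M τ (borelFC a (h c)) (borelFC a (h b)))) := by
  refine ⟨modelFunction M τ a, fun b hbM hb => ?_, fun b hbM hb => ⟨?_, ?_⟩,
    fun b hbM hb c hcM hc => ?_⟩
  · rw [borelFC_modelFunction hτ haM ha hac hbM hb]
    exact ⟨isModelFunctionOn_modelFunction hτ haM ha hac hbM hb,
      borelFC_rearrangement_mem hτ haM b, borelFC_rearrangement_nonneg hτ haM b,
      fun t ht => singularValue_borelFC_rearrangement hτ haM ha hac hbM hb ht⟩
  · rw [borelFC_modelFunction hτ haM ha hac hbM hb]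
    exact ⟨borelFC_rearrangement_eq_of_refines hτ haM ha hac hbM hb,
      refines_of_borelFC_rearrangement_eq hτ haM ha hac hbM hb⟩
  · exact continuousOn_modelFunction M τ
  · rw [borelFC_modelFunction hτ haM ha hac hbM hb, borelFC_modelFunction hτ haM ha hac hcM hc]
    have hsub : Submajorized M τ c b ↔ Submajorized M τ (borelFC a (rearrangement M τ a c))
        (borelFC a (rearrangement M τ a b)) :=
      submajorized_congr
        (fun t ht => singularValue_borelFC_rearrangement hτ haM ha hac hcM hc ht)
        (fun t ht => singularValue_borelFC_rearrangement hτ haM ha hac hbM hb ht)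
    refine ⟨spectrallyDominated_iff_borelFC_rearrangement_le hτ haM ha hac hbM hb hcM hc, hsub, ?_⟩
    rw [Majorized, Majorized, trace_borelFC_rearrangement hτ haM ha hac hbM hb,
      trace_borelFC_rearrangement hτ haM ha hac hcM hc, hsub]
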